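/- **Setting.** Let $d\ge 1$ and let $J:\mathbb Z^d\to\mathbb R$ satisfy: (i) $J(x)\ge 0$ for $x\ne 0$, and $J(0)=-\sum_{x\neq 0}J(x)$ with the sum finite; (ii) $\{x: J(x)>0\}$ generates the group $\mathbb Z^d$; (iii) $J(Tx)=J(x)$ for all $x$ and every automorphism $T$ of the nearest-neighbour graph $\mathbb Z^d$ with $T0=0$; (iv) there is $R>0$ with $J(x)=0$ whenever $|x|\ge R$ (Euclidean norm). Let $\hat J=-J(0)$. For $a\in\mathbb Z^d$ let $X=(X_t)_{t\ge0}$ be, under $P_a$ (expectation $E_a$), the continuous-time random walk on $\mathbb Z^d$ with jump rates $J$ started at $a$: its holding times are exponential with mean $1/\hat J$, and it jumps from $x$ to $y\ne x$ with probability $J(y-x)/\hat J$. Let $\Lambda\subset\mathbb Z^d$ be finite, $T_\Lambda=\inf\{t\ge 0: X_t\notin\Lambda\}$, and let $X^{(\Lambda)}_t=X_t$ for $t<T_\Lambda$ and $X^{(\Lambda)}_t=*$ (a cemetery state) for $t\ge T_\Lambda$. For $x\in\Lambda$ let $\tau_{[0,\ell],x}=\int_0^\ell \mathbf 1\{X^{(\Lambda)}_s=x\}\,ds$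 and $\tau_{[0,\ell]}=(\tau_{[0,\ell],x})_{x\in\Lambda}$. Let $\Delta^{(\Lambda)}$ be the $\Lambda\times\Lambda$ matrix with entries $\Delta^{(\Lambda)}_{x,y}=J(y-x)$. Let $n\ge1$, $g>0$, $\nu\in\mathbb R$. For $\varphi=(\varphi_x)_{x\in\Lambda}\in(\mathbb R^n)^\Lambda$ write $(\varphi,\Delta^{(\Lambda)}\varphi)=\sum_{x,y\in\Lambda}\Delta^{(\Lambda)}_{x,y}\,\varphi_x\cdot\varphi_y$, and let $dP(\varphi)=C\,e^{\frac12(\varphi,\Delta^{(\Lambda)}\varphi)}\,d\varphi$ with $C=\big(\int e^{\frac12(\varphi,\Delta^{(\Lambda)}\varphi)}d\varphi\big)^{-1}$. With $V_s(\psi)=g(\psi+s)^2+\nu(\psi+s)$ define, for $t=(t_x)_{x\in\Lambda}\in[0,\infty)^\Lambda$, $$Z_t=\int dP(\varphi)\,\exp\Big\{-\sum_{x\in\Lambda}\Big(g\big(\tfrac12|\varphi_x|^2+t_x\big)^2+\nu\big(\tfrac12|\varphi_x|^2+t_x\big)\Big)\Big\},$$ $$\langle F\rangle^{(\Lambda)}_{g,\nu,t}=\frac1{Z_t}\int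 dP(\varphi)\,F(\varphi)\prod_{x\in\Lambda}e^{-V_{t_x}(\frac12|\varphi_x|^2)},$$ and, for $a,b\in\Lambda$, $$G^{(\Lambda)}_t(a,b)=\int_{[0,\infty)}d\ell\;E_a\Big[\frac{Z_{t+\tau_{[0,\ell]}}}{Z_t}\,\mathbf 1\{X^{(\Lambda)}_\ell=b\}\Big].$$ **Theorem.** For all $a,b\in\Lambda$ and $t\in[0,\infty)^\Lambda$: $Z_t>0$, the integral defining $\langle\varphi_a\cdot\varphi_b\rangle^{(\Lambda)}_{g,\nu,t}$ converges absolutely, $G^{(\Lambda)}_t(a,b)<\infty$, and $$G^{(\Lambda)}_t(a,b)=\frac1n\,\langle\varphi_a\cdot\varphi_b\rangle^{(\Lambda)}_{g,\nu,t}.$$ -/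

import Mathlib

open MeasureTheory ProbabilityTheory
open scoped NNReal ENNReal BigOperators

namespace Phi4

noncomputable section

/-- The vertex set of the lattice `ℤ^d`. -/
abbrev Site (d : ℕ) : Type := Fin d → ℤ

/-- The nearest-neighbour graph on `ℤ^d`. -/
def latticeGraph (d : ℕ) : SimpleGraph (Site d) where
  Adj x y := ∑ i, |x i - y i| = 1
  symm := ⟨fun x y h => by simpa only [abs_sub_comm] using h⟩
  loopless := ⟨fun x h => by simp at h⟩

/-- The Euclidean norm of a lattice point. -/
def siteNorm {d : ℕ} (x : Site d) : ℝ := Real.sqrt (∑ i, (x i : ℝ) ^ 2)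

/-- The standing assumptions on the jump rates `J : ℤ^d → ℝ`. -/
structure IsJumpRate {d : ℕ} (J : Site d → ℝ) : Prop where
  /-- Off-diagonal rates are non-negative. -/
  nonneg : ∀ x, x ≠ 0 → 0 ≤ J x
  /-- `J 0 = - ∑_{x ≠ 0} J x`, the sum being finite. -/
  hasSum : HasSum (fun x : {x : Site d // x ≠ 0} => J x) (-J 0)
  /-- `{x | J x > 0}` generates `ℤ^d`. -/
  generates : AddSubgroup.closure {x | 0 < J x} = ⊤
  /-- `J` is invariant under the lattice automorphisms that fix the origin. -/
  symmetric : ∀ T : latticeGraph d ≃g latticeGraph d, T 0 = 0 → ∀ x, J (T x) = J x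
  /-- `J` has finite range. -/
  finite_range : ∃ R : ℝ, 0 < R ∧ ∀ x, R ≤ siteNorm x → J x = 0

/-- The total jump rate `Ĵ = -J 0` of the walk. -/
def totalRate {d : ℕ} (J : Site d → ℝ) : ℝ := -J 0

/-- The law of a single jump: the displacement is `y ≠ 0` with probability `J y / Ĵ`. -/
def stepLaw {d : ℕ} (J : Site d → ℝ) : Measure (Site d) :=
  Measure.sum fun y : {y : Site d // y ≠ 0} =>
    ENNReal.ofReal (J y / totalRate J) • Measure.dirac (y : Site d)

/-- `X = (X_t)_{t ≥ 0}` is, under `P`, a continuous-time random walk on `ℤ^d` with jump rates `J`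
started at `a` (only times `t ≥ 0` matter). There are successive positions `Y 0 = a, Y 1, …` and
holding times `σ 0, σ 1, …` such that the displacements `Y (k+1) - Y k` and the holding times `σ k`
are all independent, displacements have law `stepLaw J`, holding times are exponential with rate
`Ĵ` (mean `1/Ĵ`), and almost surely `X` sits at `Y m` during its `m`-th holding interval. -/
def IsRandomWalk {d : ℕ} (J : Site d → ℝ) (a : Site d) {Ω : Type*} [MeasurableSpace Ω]
    (P : Measure Ω) (X : ℝ → Ω → Site d) : Prop :=
  ∃ (Y : ℕ → Ω → Site d) (σ : ℕ → Ω → ℝ),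
    (∀ᵐ ω ∂P, Y 0 ω = a) ∧
    iIndepFun (fun k ω => (Y (k + 1) ω - Y k ω, σ k ω)) P ∧
    (∀ k, HasLaw (fun ω => (Y (k + 1) ω - Y k ω, σ k ω))
      ((stepLaw J).prod (expMeasure (totalRate J))) P) ∧
    ∀ᵐ ω ∂P, ∀ (t : ℝ) (m : ℕ), 0 ≤ t → ∑ k ∈ Finset.range m, σ k ω ≤ t →
      t < ∑ k ∈ Finset.range (m + 1), σ k ω → X t ω = Y m ω

/-- The first time `inf {t ≥ 0 | X_t ∉ Λ}` at which `X` exits `Λ` (`⊤` if it never does). -/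
def exitTime {d : ℕ} (Λ : Finset (Site d)) {Ω : Type*} (X : ℝ → Ω → Site d) (ω : Ω) : EReal :=
  ⨅ (t : ℝ) (_ : 0 ≤ t ∧ X t ω ∉ Λ), (t : EReal)

open Classical in
/-- The walk killed on exiting `Λ`; the value `none` is the cemetery state. -/
def killedWalk {d : ℕ} (Λ : Finset (Site d)) {Ω : Type*} (X : ℝ → Ω → Site d)
    (t : ℝ) (ω : Ω) : Option (Site d) :=
  if (t : EReal) < exitTime Λ X ω then some (X t ω) else none

open Classical in
/-- The local time of the killed walk at `x` during the time set `I`. -/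
def localTime {d : ℕ} (Λ : Finset (Site d)) {Ω : Type*} (X : ℝ → Ω → Site d)
    (I : Set ℝ) (ω : Ω) (x : Λ) : ℝ :=
  ∫ s in I, if killedWalk Λ X s ω = some (x : Site d) then (1 : ℝ) else 0

open Classical in
/-- The Green's function
`∫_{[0,∞)} dℓ E[(Z (t + τ_{[0,ℓ]}) / Z t) 1{X^Λ_ℓ = b}]` attached to a weight `Z`, as an integral
of a non-negative function with values in `[0,∞]`. The starting point is that of `X` under `P`. -/
def greenFunction {d : ℕ} (Λ : Finset (Site d)) {Ω : Type*} [MeasurableSpace Ω]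
    (P : Measure Ω) (X : ℝ → Ω → Site d) (Z : (Λ → ℝ) → ℝ) (t : Λ → ℝ) (b : Λ) : ℝ≥0∞ :=
  ∫⁻ ℓ in Set.Ici (0 : ℝ), ∫⁻ ω,
    (if killedWalk Λ X ℓ ω = some (b : Site d) then
      ENNReal.ofReal (Z (t + localTime Λ X (Set.Icc 0 ℓ) ω) / Z t) else 0) ∂P

/-- Spin configurations: an `ℝ^n`-valued spin at every point of `Λ`. -/
abbrev SpinConfig {d : ℕ} (Λ : Finset (Site d)) (n : ℕ) : Type :=
  Λ → EuclideanSpace ℝ (Fin n)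

/-- The matrix `Δ^Λ` with entries `J (y - x)`, for `x, y ∈ Λ`. -/
def laplacian {d : ℕ} (J : Site d → ℝ) (Λ : Finset (Site d)) : Matrix Λ Λ ℝ :=
  fun x y => J ((y : Site d) - (x : Site d))

/-- The quadratic form `(φ, Δ^Λ φ)`, with `Δ^Λ` acting on each component of `φ`. -/
def dirichletForm {d : ℕ} (J : Site d → ℝ) (Λ : Finset (Site d)) {n : ℕ}
    (φ : SpinConfig Λ n) : ℝ :=
  ∑ x, ∑ i, φ x i * ∑ y, laplacian J Λ x y * φ y i

/-- The constant `C` that normalises the Gaussian density `exp (½ (φ, Δ^Λ φ))`. -/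
def gaussianConst {d : ℕ} (J : Site d → ℝ) (Λ : Finset (Site d)) (n : ℕ) : ℝ :=
  (∫ φ : SpinConfig Λ n, Real.exp (1 / 2 * dirichletForm J Λ φ))⁻¹

/-- The centred Gaussian measure `dP(φ) = C exp (½ (φ, Δ^Λ φ)) dφ` on spin configurations. -/
def gaussianMeasure {d : ℕ} (J : Site d → ℝ) (Λ : Finset (Site d)) (n : ℕ) :
    Measure (SpinConfig Λ n) :=
  volume.withDensity fun φ =>
    ENNReal.ofReal (gaussianConst J Λ n * Real.exp (1 / 2 * dirichletForm J Λ φ))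

/-- The single-site potential `V_s(ψ) = g (ψ + s)² + ν (ψ + s)`. -/
def potential (g ν s ψ : ℝ) : ℝ := g * (ψ + s) ^ 2 + ν * (ψ + s)

/-- The weight `∏_x exp (-V_{t_x}(½ |φ_x|²))`. -/
def interaction {d : ℕ} {Λ : Finset (Site d)} {n : ℕ} (g ν : ℝ) (t : Λ → ℝ)
    (φ : SpinConfig Λ n) : ℝ :=
  ∏ x, Real.exp (-potential g ν (t x) (1 / 2 * ‖φ x‖ ^ 2))

/-- The weight `Z_t = ∫ dP(φ) exp (-∑_x (g (½|φ_x|² + t_x)² + ν (½|φ_x|² + t_x)))` of the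
`n`-component `g|φ|⁴` model. -/
def phi4Z {d : ℕ} (J : Site d → ℝ) (Λ : Finset (Site d)) (n : ℕ) (g ν : ℝ) (t : Λ → ℝ) : ℝ :=
  ∫ φ, Real.exp (-∑ x, (g * (1 / 2 * ‖φ x‖ ^ 2 + t x) ^ 2 + ν * (1 / 2 * ‖φ x‖ ^ 2 + t x)))
    ∂gaussianMeasure J Λ n

/-- The spin expectation `⟨F⟩_{g,ν,t}`, the normalised integral of `F` against
`exp (½ (φ, Δ^Λ φ)) ∏_x exp (-V_{t_x}(½ |φ_x|²)) dφ`; the Gaussian constant `C` is part of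
`gaussianMeasure` and of `phi4Z`, so that `⟨1⟩ = 1`. -/
def spinExpectation {d : ℕ} (J : Site d → ℝ) (Λ : Finset (Site d)) (n : ℕ) (g ν : ℝ)
    (t : Λ → ℝ) (F : SpinConfig Λ n → ℝ) : ℝ :=
  1 / phi4Z J Λ n g ν t * ∫ φ, F φ * interaction g ν t φ ∂gaussianMeasure J Λ n

/-- In positive dimension the total jump rate is positive. -/
theorem IsJumpRate.totalRate_pos {d : ℕ} (hd : 1 ≤ d) {J : Site d → ℝ} (hJ : IsJumpRate J) :
    0 < totalRate J := by
  have hnn : ∀ x : {x : Site d // x ≠ 0}, 0 ≤ J x := fun x => hJ.nonneg x x.2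
  have h0 : 0 ≤ -J 0 := hJ.hasSum.nonneg hnn
  by_contra hcon
  have hz : -J 0 = 0 := le_antisymm (not_lt.mp hcon) h0
  have hs := hJ.hasSum
  rw [hz, hasSum_zero_iff_of_nonneg hnn] at hs
  have hempty : {x | 0 < J x} = (∅ : Set (Site d)) := by
    ext x
    simp only [Set.mem_ofPred_eq, Set.mem_empty_iff_false, iff_false, not_lt]
    by_cases hx : x = 0
    · subst hx; linarith
    · exact le_of_eq (congrFun hs ⟨x, hx⟩)
  have hg := hJ.generates
  rw [hempty, AddSubgroup.closure_empty] at hg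
  have hm : (fun _ => 1 : Site d) ∈ (⊥ : AddSubgroup (Site d)) := by rw [hg]; trivial
  have := congrFun (AddSubgroup.mem_bot.mp hm) ⟨0, hd⟩
  simp at this

theorem isProbabilityMeasure_stepLaw {d : ℕ} (hd : 1 ≤ d) {J : Site d → ℝ} (hJ : IsJumpRate J) :
    IsProbabilityMeasure (stepLaw J) := by
  have hpos := hJ.totalRate_pos hd
  constructor
  rw [stepLaw, Measure.sum_apply _ MeasurableSet.univ]
  simp only [Measure.smul_apply, measure_univ, smul_eq_mul, mul_one]
  have hs : HasSum (fun x : {x : Site d // x ≠ 0} => J x / totalRate J) 1 := by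
    have h := hJ.hasSum.div_const (totalRate J)
    rwa [show -J 0 = totalRate J from rfl, div_self hpos.ne'] at h
  have hnn : ∀ x : {x : Site d // x ≠ 0}, 0 ≤ J x / totalRate J :=
    fun x => div_nonneg (hJ.nonneg x x.2) hpos.le
  exact (ENNReal.ofReal_tsum_of_nonneg hnn hs.summable).symm.trans (by rw [hs.tsum_eq]; simp)

/-- The random walk exists, from every starting point. -/
theorem exists_isRandomWalk {d : ℕ} (hd : 1 ≤ d) {J : Site d → ℝ} (hJ : IsJumpRate J)
    (a : Site d) :
    ∃ (Ω : Type) (_ : MeasurableSpace Ω) (P : Measure Ω) (X : ℝ → Ω → Site d),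
      IsProbabilityMeasure P ∧ IsRandomWalk J a P X := by
  classical
  have := isProbabilityMeasure_stepLaw hd hJ
  have := isProbabilityMeasure_expMeasure (hJ.totalRate_pos hd)
  obtain ⟨Ω, mΩ, P, W, -, hlaw, hind, hP⟩ :=
    exists_iid ℕ ((stepLaw J).prod (expMeasure (totalRate J)))
  let Y : ℕ → Ω → Site d := fun m ω => a + ∑ k ∈ Finset.range m, (W k ω).1
  let S : ℕ → Ω → ℝ := fun m ω => ∑ k ∈ Finset.range m, (W k ω).2
  let X : ℝ → Ω → Site d := fun t ω =>
    if h : ∃ m, S m ω ≤ t ∧ t < S (m + 1) ω then Y (Nat.find h) ω else a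
  have hW : ∀ k, (fun ω => (Y (k + 1) ω - Y k ω, (W k ω).2)) = W k := by
    intro k; funext ω
    simp [Y, Finset.sum_range_succ]
  refine ⟨Ω, mΩ, P, X, hP, Y, fun k ω => (W k ω).2, ?_, ?_, ?_, ?_⟩
  · simp [Y]
  · rw [funext hW]; exact hind
  · intro k; rw [hW]; exact hlaw k
  · have hnn : ∀ k, ∀ᵐ ω ∂P, 0 ≤ (W k ω).2 := by
      intro k
      have hsnd : HasLaw (fun ω => (W k ω).2) (expMeasure (totalRate J)) P := by
        refine ⟨(hlaw k).aemeasurable.snd, ?_⟩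
        change P.map (Prod.snd ∘ W k) = _
        rw [← AEMeasurable.map_map_of_aemeasurable (g := Prod.snd)
          measurable_snd.aemeasurable (hlaw k).aemeasurable, (hlaw k).map_eq]
        exact Measure.map_snd_prod.trans (by simp)
      have h0 : P {ω | (W k ω).2 < 0} = 0 := by
        rw [hsnd.measure_eq measurableSet_Iio]
        change expMeasure (totalRate J) (Set.Iio 0) = 0
        rw [expMeasure, gammaMeasure,
          withDensity_apply _ measurableSet_Iio]
        exact lintegral_gammaPDF_of_nonpos le_rfl
      rw [ae_iff]
      simpa only [not_le] using h0
    filter_upwards [ae_all_iff.mpr hnn] with ω hω t m _ h1 h2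
    have hmono : Monotone fun m => S m ω := monotone_nat_of_le_succ fun m => by
      simp only [S, Finset.sum_range_succ]; linarith [hω m]
    have h : ∃ m, S m ω ≤ t ∧ t < S (m + 1) ω := ⟨m, h1, h2⟩
    have hf := Nat.find_spec h
    have heq : Nat.find h = m := by
      rcases lt_trichotomy (Nat.find h) m with hlt | he | hgt
      · exact absurd (hf.2.trans_le (hmono (Nat.succ_le_of_lt hlt))) (not_lt.mpr h1)
      · exact he
      · exact absurd (h2.trans_le (hmono (Nat.succ_le_of_lt hgt))) (not_lt.mpr hf.1)
    simp only [X, dif_pos h, heq]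

end

end Phi4

/-! The two-point function and the local-time expectation are identified by one linear evolution
equation. Write `K s x` for `twoPoint`, that is `1/n` times the integral of `φ x · φ b` against the
unnormalised weight with background field `s`, and `Z s` for `partitionFn`. The potential sees `s x`
and `φ x` only through `½|φ x|² + s x`, so its gradient in `φ x` is `φ x` times its derivative in `s
x`. Integration by parts in `φ x` therefore gives (`hasDerivAt_twoPoint`) `∂K(s,x)/∂s_x = -∑ y, Δ_xy
K(s,y) - 1{x=b} Z(s)`. The operator `∂/∂s_x + Δ` is the generator of the Markov process (local time,
position) of the killed walk, because the local time at the current site grows at unit speed. Hence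
`K` is a potential with source `Z` at `b`, and `K t a` should equal the expected integral over `ℓ`
of `Z (t + τ_[0,ℓ]) 1{X_ℓ = b}`, provided nothing survives at infinity.

This is made rigorous on the jump chain rather than by semigroup theory. Over one holding interval
the equation is a scalar linear ODE; its bounded solution, averaged over an exponential holding time
and a jump, gives the renewal identity `IsRenewalPair.one_step`. Iterating along the chain
telescopes (`IsRenewalPair.hasSum`). The remainder vanishes because `K` decays exponentially in the
total local time, which equals elapsed time while the walk is alive (`sum_chainPath`), and the jump
times diverge (`IsDriving.ae_tendsto_jumpTime`). Finally `FollowsJumps.integrand_eq_tsum` cuts the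
Green's function integrand along holding intervals, and Tonelli gives
`IsRenewalPair.lintegral_green`.

All integrals converge because the quartic term beats any linear function of `½|φ|² + s`
(`exists_spinWeight_le`), while the Gaussian normalisation needs the Dirichlet form to be strictly
negative (`IsJumpRate.exists_quadratic_form_le`). -/

namespace Phi4

/-! ### The Dirichlet form is negative definite -/

section JumpRate

variable {d : ℕ} {J : Site d → ℝ}

/-- Negation is a lattice automorphism fixing the origin. This is the only symmetry the argument
needs: it makes the Laplacian symmetric and the walk centred. -/
theorem IsJumpRate.neg_apply (hJ : IsJumpRate J) (x : Site d) : J (-x) = J x := by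
  let T : latticeGraph d ≃g latticeGraph d :=
    { toEquiv := Equiv.neg (Site d)
      map_rel_iff' := by
        intro x y
        change (∑ i, |(-x) i - (-y) i| = 1) ↔ (∑ i, |x i - y i| = 1)
        have h : ∀ i, |(-x) i - (-y) i| = |x i - y i| := fun i => by
          rw [← abs_neg]; congr 1; simp; ring
        simp only [h] }
  exact hJ.symmetric T (by change -(0 : Site d) = 0; simp) x

theorem IsJumpRate.finite_support (hJ : IsJumpRate J) : {x | J x ≠ 0}.Finite := by
  obtain ⟨R, -, hR⟩ := hJ.finite_range
  refine (Set.finite_Icc (fun _ => -⌈R⌉ : Site d) (fun _ => ⌈R⌉)).subset fun x hx => ?_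
  have hlt : siteNorm x < R := by
    by_contra h
    exact hx (hR x (not_lt.mp h))
  have hi : ∀ i, |(x i : ℝ)| ≤ ⌈R⌉ := fun i => by
    refine le_trans ?_ (hlt.le.trans (Int.le_ceil R))
    refine Real.le_sqrt_of_sq_le ?_
    rw [sq_abs]
    exact Finset.single_le_sum (f := fun i => (x i : ℝ) ^ 2) (fun i _ => sq_nonneg _)
      (Finset.mem_univ i)
  constructor <;> intro i
  · have := (abs_le.mp (hi i)).1
    exact_mod_cast this
  · have := (abs_le.mp (hi i)).2
    exact_mod_cast this

/-- The finite set of possible displacements of the walk. -/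
noncomputable def IsJumpRate.steps (hJ : IsJumpRate J) : Finset (Site d) :=
  hJ.finite_support.toFinset.erase 0

theorem IsJumpRate.mem_steps (hJ : IsJumpRate J) {x : Site d} :
    x ∈ hJ.steps ↔ x ≠ 0 ∧ J x ≠ 0 := by
  simp [IsJumpRate.steps]

theorem IsJumpRate.sum_steps (hJ : IsJumpRate J) : ∑ z ∈ hJ.steps, J z = totalRate J := by
  classical
  have h1 : HasSum (Set.indicator {x : Site d | x ≠ 0} J) (-J 0) :=
    (hasSum_subtype_iff_indicator (s := {x : Site d | x ≠ 0})).mp hJ.hasSum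
  have h2 : HasSum (Set.indicator {x : Site d | x ≠ 0} J)
      (∑ z ∈ hJ.steps, Set.indicator {x : Site d | x ≠ 0} J z) := by
    refine hasSum_sum_of_ne_finset_zero fun z hz => ?_
    rw [hJ.mem_steps] at hz
    by_cases h0 : z = 0
    · simp [h0]
    · rw [Set.indicator_of_mem (by exact h0)]
      by_contra h
      exact hz ⟨h0, h⟩
  have h3 := h2.unique h1
  rw [totalRate, ← h3]
  refine Finset.sum_congr rfl fun z hz => ?_
  rw [Set.indicator_of_mem (by exact (hJ.mem_steps.mp hz).1)]

theorem IsJumpRate.pos_of_mem_steps (hJ : IsJumpRate J) {z : Site d} (hz : z ∈ hJ.steps) :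
    0 < J z := by
  rw [hJ.mem_steps] at hz
  exact lt_of_le_of_ne (hJ.nonneg z hz.1) hz.2.symm

theorem IsJumpRate.sum_steps_mul_coord (hJ : IsJumpRate J) (i : Fin d) :
    ∑ z ∈ hJ.steps, J z * (z i : ℝ) = 0 := by
  have h : ∑ z ∈ hJ.steps, J z * (z i : ℝ) = ∑ z ∈ hJ.steps, -(J z * (z i : ℝ)) := by
    refine Finset.sum_nbij' (fun z => -z) (fun z => -z) ?_ ?_ ?_ ?_ ?_
    · intro z hz
      rw [hJ.mem_steps] at hz ⊢
      rwa [hJ.neg_apply, neg_ne_zero]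
    · intro z hz
      rw [hJ.mem_steps] at hz ⊢
      rwa [hJ.neg_apply, neg_ne_zero]
    · simp
    · simp
    · intro z _
      rw [hJ.neg_apply]
      simp
  rw [Finset.sum_neg_distrib] at h
  linarith

/-- If the variance of a coordinate vanished, every step would lie in the kernel of that coordinate,
and the steps could not generate the lattice. -/
theorem IsJumpRate.sum_steps_mul_coord_sq_pos (hJ : IsJumpRate J) (i : Fin d) :
    0 < ∑ z ∈ hJ.steps, J z * (z i : ℝ) ^ 2 := by
  have hnn : ∀ z ∈ hJ.steps, 0 ≤ J z * (z i : ℝ) ^ 2 := fun z hz =>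
    mul_nonneg (hJ.pos_of_mem_steps hz).le (sq_nonneg _)
  refine lt_of_le_of_ne (Finset.sum_nonneg hnn) fun h0 => ?_
  have hz := (Finset.sum_eq_zero_iff_of_nonneg hnn).mp h0.symm
  let H : AddSubgroup (Site d) := (Pi.evalAddMonoidHom (fun _ : Fin d => ℤ) i).ker
  have hle : AddSubgroup.closure {x | 0 < J x} ≤ H := by
    rw [AddSubgroup.closure_le]
    intro x hx
    have hx : 0 < J x := hx
    by_cases hx0 : x = 0
    · subst hx0; exact H.zero_mem
    have := hz x (hJ.mem_steps.mpr ⟨hx0, hx.ne'⟩)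
    have hxi : (x i : ℝ) = 0 := by
      rcases mul_eq_zero.mp this with h | h
      · exact absurd h hx.ne'
      · exact pow_eq_zero_iff (two_ne_zero) |>.mp h
    exact (AddMonoidHom.mem_ker).mpr (by exact_mod_cast hxi)
  rw [hJ.generates] at hle
  have hm : (fun _ => 1 : Site d) ∈ H := hle trivial
  have : (1 : ℤ) = 0 := (AddMonoidHom.mem_ker).mp hm
  exact one_ne_zero this

/-- A positive strictly superharmonic function for the killed walk. -/
theorem IsJumpRate.exists_superharmonic (hd : 1 ≤ d) (hJ : IsJumpRate J) (Λ : Finset (Site d)) :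
    ∃ (h : Site d → ℝ) (A c : ℝ), 0 < A ∧ 0 < c ∧ (∀ x ∈ Λ, 0 < h x ∧ h x ≤ A) ∧
      ∀ x ∈ Λ, ∑ y ∈ Λ.erase x, J (y - x) * h y ≤ totalRate J * h x - c := by
  classical
  let i : Fin d := ⟨0, hd⟩
  -- The superharmonic function is `A - (x i)²`: steps have mean zero, so the generator lowers it by
  -- exactly the variance of the coordinate. `A` is large enough to keep it positive on `Λ` and
  -- non-negative at every site reachable from `Λ` in one step.
  let A : ℝ := 1 + ∑ x ∈ Λ, (x i : ℝ) ^ 2 + ∑ x ∈ Λ, ∑ z ∈ hJ.steps, ((x i : ℝ) + z i) ^ 2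
  have hB1 : 0 ≤ ∑ x ∈ Λ, (x i : ℝ) ^ 2 := Finset.sum_nonneg fun _ _ => sq_nonneg _
  have hB2 : 0 ≤ ∑ x ∈ Λ, ∑ z ∈ hJ.steps, ((x i : ℝ) + z i) ^ 2 :=
    Finset.sum_nonneg fun _ _ => Finset.sum_nonneg fun _ _ => sq_nonneg _
  refine ⟨fun x => A - (x i : ℝ) ^ 2, A, ∑ z ∈ hJ.steps, J z * (z i : ℝ) ^ 2, ?_,
    hJ.sum_steps_mul_coord_sq_pos i, ?_, ?_⟩
  · positivity
  · intro x hx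
    have := Finset.single_le_sum (f := fun x : Site d => (x i : ℝ) ^ 2)
      (fun _ _ => sq_nonneg _) hx
    refine ⟨?_, by nlinarith [sq_nonneg (x i : ℝ)]⟩
    simp only [A]
    linarith
  · intro x hx
    have hpos : ∀ z ∈ hJ.steps, 0 ≤ A - ((x i : ℝ) + z i) ^ 2 := fun z hz => by
      have h1 := Finset.single_le_sum (f := fun z : Site d => ((x i : ℝ) + z i) ^ 2)
        (fun _ _ => sq_nonneg _) hz
      have h2 := Finset.single_le_sum
        (f := fun x : Site d => ∑ z ∈ hJ.steps, ((x i : ℝ) + z i) ^ 2)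
        (fun _ _ => Finset.sum_nonneg fun _ _ => sq_nonneg _) hx
      simp only [A]
      linarith
    have e1 : ∑ y ∈ Λ.erase x, J (y - x) * (A - (y i : ℝ) ^ 2) =
        ∑ z ∈ (Λ.erase x).image (· - x), J z * (A - ((x i : ℝ) + z i) ^ 2) := by
      rw [Finset.sum_image (fun y _ y' _ h => sub_left_injective h)]
      refine Finset.sum_congr rfl fun y _ => ?_
      simp
    have e2 : ∑ z ∈ (Λ.erase x).image (· - x), J z * (A - ((x i : ℝ) + z i) ^ 2) =
        ∑ z ∈ ((Λ.erase x).image (· - x)).filter (· ∈ hJ.steps),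
          J z * (A - ((x i : ℝ) + z i) ^ 2) := by
      rw [Finset.sum_filter_of_ne]
      intro z hz hne
      rw [hJ.mem_steps]
      refine ⟨?_, left_ne_zero_of_mul hne⟩
      obtain ⟨y, hy, rfl⟩ := Finset.mem_image.mp hz
      exact sub_ne_zero.mpr (Finset.ne_of_mem_erase hy)
    -- Jumps that leave `Λ` are added back; their terms are non-negative by `hpos`.
    have e3 : ∑ z ∈ ((Λ.erase x).image (· - x)).filter (· ∈ hJ.steps),
          J z * (A - ((x i : ℝ) + z i) ^ 2) ≤
        ∑ z ∈ hJ.steps, J z * (A - ((x i : ℝ) + z i) ^ 2) := by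
      refine Finset.sum_le_sum_of_subset_of_nonneg
        (fun z hz => (Finset.mem_filter.mp hz).2) fun z hz _ => ?_
      exact mul_nonneg (hJ.pos_of_mem_steps hz).le (hpos z hz)
    have e4 : ∑ z ∈ hJ.steps, J z * (A - ((x i : ℝ) + z i) ^ 2) =
        (∑ z ∈ hJ.steps, J z) * (A - (x i : ℝ) ^ 2) -
          2 * x i * (∑ z ∈ hJ.steps, J z * (z i : ℝ)) -
          ∑ z ∈ hJ.steps, J z * (z i : ℝ) ^ 2 := by
      rw [Finset.sum_mul, Finset.mul_sum, ← Finset.sum_sub_distrib, ← Finset.sum_sub_distrib]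
      exact Finset.sum_congr rfl fun z _ => by ring
    rw [hJ.sum_steps_mul_coord, hJ.sum_steps] at e4
    rw [e1, e2]
    linarith

/-- Barta's inequality: the killed generator is strictly negative definite. -/
theorem IsJumpRate.exists_quadratic_form_le (hd : 1 ≤ d) (hJ : IsJumpRate J)
    (Λ : Finset (Site d)) :
    ∃ c : ℝ, 0 < c ∧ ∀ u : Λ → ℝ,
      ∑ x, u x * ∑ y, laplacian J Λ x y * u y ≤ -c * ∑ x, u x ^ 2 := by
  classical
  obtain ⟨h, A, c, hA, hc, hh, hsup⟩ := hJ.exists_superharmonic hd Λ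
  refine ⟨c / A, by positivity, fun u => ?_⟩
  -- The off-diagonal part of the Laplacian, whose entries are non-negative and symmetric.
  let m : Λ → Λ → ℝ := fun x y => if x = y then 0 else J ((y : Site d) - x)
  have hm0 : ∀ x y, 0 ≤ m x y := fun x y => by
    simp only [m]
    split_ifs with e
    · exact le_rfl
    · exact hJ.nonneg _ (sub_ne_zero.mpr fun h' => e (Subtype.ext h'.symm))
  have hmsymm : ∀ x y, m x y = m y x := fun x y => by
    simp only [m]
    by_cases e : x = y
    · simp [e]
    · rw [if_neg e, if_neg (Ne.symm e), ← hJ.neg_apply, neg_sub]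
  have hl : ∀ x y, laplacian J Λ x y = m x y - if x = y then totalRate J else 0 := fun x y => by
    simp only [m, laplacian, totalRate]
    by_cases e : x = y
    · simp [e]
    · simp [e]
  have hsup' : ∀ x : Λ, ∑ y : Λ, m x y * h y ≤ totalRate J * h x - c := fun x => by
    refine le_trans (le_of_eq ?_) (hsup x x.2)
    have e1 : ∑ y : Λ, m x y * h y =
        ∑ y ∈ Λ, (if (x : Site d) = y then 0 else J (y - x)) * h y := by
      rw [← Finset.sum_coe_sort Λ fun y => (if (x : Site d) = y then 0 else J (y - x)) * h y]
      refine Finset.sum_congr rfl fun y _ => ?_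
      simp only [m, Subtype.ext_iff]
    rw [e1, ← Finset.sum_erase (s := Λ) (a := (x : Site d)) (by simp)]
    refine Finset.sum_congr rfl fun y hy => ?_
    rw [if_neg (Finset.ne_of_mem_erase hy).symm]
  -- Weighted AM-GM with weights `h y / h x` and `h x / h y`. By symmetry of `m` the two halves have
  -- the same double sum, and superharmonicity of `h` then bounds the inner sum.
  have key : ∑ x, u x * ∑ y, m x y * u y ≤ ∑ x, u x ^ 2 / h x * ∑ y, m x y * h y := by
    have h1 : ∀ x y : Λ, u x * (m x y * u y) ≤
        1 / 2 * (u x ^ 2 / h x * (m x y * h y)) + 1 / 2 * (u y ^ 2 / h y * (m y x * h x)) := by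
      intro x y
      have hx := (hh x x.2).1
      have hy := (hh y y.2).1
      have h2 : u x * u y ≤ 1 / 2 * (u x ^ 2 / h x * h y) + 1 / 2 * (u y ^ 2 / h y * h x) := by
        have : 1 / 2 * (u x ^ 2 / h x * h y) + 1 / 2 * (u y ^ 2 / h y * h x) - u x * u y =
            1 / 2 * (u x * h y - u y * h x) ^ 2 / (h x * h y) := by
          field_simp
          ring
        have h3 : 0 ≤ 1 / 2 * (u x * h y - u y * h x) ^ 2 / (h x * h y) := by positivity
        linarith
      rw [hmsymm y x]
      nlinarith [mul_le_mul_of_nonneg_left h2 (hm0 x y)]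
    calc ∑ x, u x * ∑ y, m x y * u y = ∑ x, ∑ y, u x * (m x y * u y) := by
          simp only [Finset.mul_sum]
      _ ≤ ∑ x, ∑ y, (1 / 2 * (u x ^ 2 / h x * (m x y * h y)) +
            1 / 2 * (u y ^ 2 / h y * (m y x * h x))) :=
          Finset.sum_le_sum fun x _ => Finset.sum_le_sum fun y _ => h1 x y
      _ = ∑ x, u x ^ 2 / h x * ∑ y, m x y * h y := by
          simp only [Finset.sum_add_distrib]
          rw [Finset.sum_comm (f := fun x y : Λ => 1 / 2 * (u y ^ 2 / h y * (m y x * h x))),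
            ← Finset.sum_add_distrib]
          refine Finset.sum_congr rfl fun x _ => ?_
          rw [← Finset.sum_add_distrib, Finset.mul_sum]
          exact Finset.sum_congr rfl fun y _ => by ring
  have hdiag : ∑ x, u x * ∑ y, laplacian J Λ x y * u y =
      ∑ x, u x * ∑ y, m x y * u y - ∑ x, totalRate J * u x ^ 2 := by
    rw [← Finset.sum_sub_distrib]
    refine Finset.sum_congr rfl fun x _ => ?_
    simp only [hl, sub_mul, Finset.sum_sub_distrib, ite_mul, zero_mul, Finset.sum_ite_eq,
      Finset.mem_univ, if_true]
    ring
  rw [hdiag, Finset.mul_sum, ← sub_nonneg]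
  have : ∑ x, u x ^ 2 / h x * ∑ y, m x y * h y ≤
      ∑ x, totalRate J * u x ^ 2 + ∑ x, -(c / A) * u x ^ 2 := by
    rw [← Finset.sum_add_distrib]
    refine Finset.sum_le_sum fun x _ => ?_
    have hx := (hh x x.2).1
    calc u x ^ 2 / h x * ∑ y, m x y * h y ≤ u x ^ 2 / h x * (totalRate J * h x - c) :=
          mul_le_mul_of_nonneg_left (hsup' x) (by positivity)
      _ = totalRate J * u x ^ 2 - c * u x ^ 2 / h x := by field_simp
      _ ≤ totalRate J * u x ^ 2 - c * u x ^ 2 / A := by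
          have := div_le_div_of_nonneg_left (by positivity : 0 ≤ c * u x ^ 2) hx (hh x x.2).2
          linarith
      _ = _ := by ring
  linarith

theorem IsJumpRate.exists_dirichletForm_le (hd : 1 ≤ d) (hJ : IsJumpRate J)
    (Λ : Finset (Site d)) (n : ℕ) :
    ∃ c : ℝ, 0 < c ∧ ∀ φ : SpinConfig Λ n,
      dirichletForm J Λ φ ≤ -c * ∑ x, ‖φ x‖ ^ 2 := by
  obtain ⟨c, hc, h⟩ := hJ.exists_quadratic_form_le hd Λ
  refine ⟨c, hc, fun φ => ?_⟩
  simp only [dirichletForm, EuclideanSpace.real_norm_sq_eq]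
  rw [Finset.sum_comm, Finset.sum_comm (f := fun x i => (φ x i) ^ 2), Finset.mul_sum]
  exact Finset.sum_le_sum fun i _ => h fun x => φ x i

end JumpRate

/-! ### Spin integrals -/

section SpinIntegrals

variable {d : ℕ} {Λ : Finset (Site d)} {n : ℕ}

theorem integrable_exp_neg_sum_sq {c : ℝ} (hc : 0 < c) :
    Integrable fun φ : SpinConfig Λ n => Real.exp (-c * ∑ x, ‖φ x‖ ^ 2) := by
  have h1 : Integrable fun v : EuclideanSpace ℝ (Fin n) => Real.exp (-c * ‖v‖ ^ 2) := by
    have h := (GaussianFourier.integrable_cexp_neg_mul_sq_norm_add (b := (c : ℂ))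
      (V := EuclideanSpace ℝ (Fin n)) (by simpa using hc) 0 0).norm
    refine h.congr (Filter.Eventually.of_forall fun v => ?_)
    simp only [Complex.norm_exp]
    congr 1
    simp [← Complex.ofReal_pow]
  have h2 := Integrable.fintype_prod
    (μ := fun _ : Λ => (volume : Measure (EuclideanSpace ℝ (Fin n))))
    (f := fun _ v => Real.exp (-c * ‖v‖ ^ 2)) fun _ => h1
  refine h2.congr (Filter.Eventually.of_forall fun φ => ?_)
  simp only
  rw [← Real.exp_sum, Finset.mul_sum]

theorem continuous_dirichletForm (J : Site d → ℝ) :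
    Continuous fun φ : SpinConfig Λ n => dirichletForm J Λ φ := by
  unfold dirichletForm
  fun_prop

theorem integrable_exp_dirichletForm {J : Site d → ℝ} (hd : 1 ≤ d) (hJ : IsJumpRate J) :
    Integrable fun φ : SpinConfig Λ n => Real.exp (1 / 2 * dirichletForm J Λ φ) := by
  obtain ⟨c, hc, h⟩ := hJ.exists_dirichletForm_le hd Λ n
  refine (integrable_exp_neg_sum_sq (c := c / 2) (by positivity)).mono' ?_ ?_
  · exact (Real.continuous_exp.comp
      (continuous_const.mul (continuous_dirichletForm J))).aestronglyMeasurable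
  · refine Filter.Eventually.of_forall fun φ => ?_
    rw [Real.norm_eq_abs, Real.abs_exp, Real.exp_le_exp]
    linarith [h φ]

theorem gaussianConst_pos {J : Site d → ℝ} (hd : 1 ≤ d) (hJ : IsJumpRate J) :
    0 < gaussianConst J Λ n :=
  inv_pos.mpr (integral_exp_pos (integrable_exp_dirichletForm hd hJ))

/-- The density `exp (½ (φ, Δ^Λ φ)) ∏ₓ exp (-V_{sₓ}(½ |φₓ|²))` of the interacting model. -/
noncomputable def spinWeight (J : Site d → ℝ) (g ν : ℝ) (s : Λ → ℝ) (φ : SpinConfig Λ n) : ℝ :=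
  Real.exp (1 / 2 * dirichletForm J Λ φ) * interaction g ν s φ

theorem spinWeight_eq_exp (J : Site d → ℝ) (g ν : ℝ) (s : Λ → ℝ) (φ : SpinConfig Λ n) :
    spinWeight J g ν s φ = Real.exp (1 / 2 * dirichletForm J Λ φ -
      ∑ x, potential g ν (s x) (1 / 2 * ‖φ x‖ ^ 2)) := by
  rw [spinWeight, interaction, ← Real.exp_sum, ← Real.exp_add, Finset.sum_neg_distrib,
    sub_eq_add_neg]

theorem spinWeight_pos (J : Site d → ℝ) (g ν : ℝ) (s : Λ → ℝ) (φ : SpinConfig Λ n) :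
    0 < spinWeight J g ν s φ := by
  rw [spinWeight_eq_exp]
  exact Real.exp_pos _

theorem continuous_spinWeight_right (J : Site d → ℝ) (g ν : ℝ) (s : Λ → ℝ) :
    Continuous fun φ : SpinConfig Λ n => spinWeight J g ν s φ := by
  simp only [spinWeight_eq_exp, potential, dirichletForm]
  fun_prop

theorem continuous_spinWeight_left (J : Site d → ℝ) (g ν : ℝ) (φ : SpinConfig Λ n) :
    Continuous fun s : Λ → ℝ => spinWeight J g ν s φ := by
  simp only [spinWeight_eq_exp, potential]
  fun_prop

/-- A convex parabola in `u = ½|φ x|² + s x` lies above a line of any slope. Slope 8 yields decay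
rate 8 in `s` and 4 in `|φ|²`, valid for fields `s` of any sign. The rate 4 leaves room for
observables growing like `exp (3 ∑ |φ x|²)`. -/
theorem exists_spinWeight_le {J : Site d → ℝ} (hd : 1 ≤ d) (hJ : IsJumpRate J)
    {g : ℝ} (hg : 0 < g) (ν : ℝ) :
    ∃ C : ℝ, 0 < C ∧ ∀ (s : Λ → ℝ) (φ : SpinConfig Λ n),
      spinWeight J g ν s φ ≤
        C * Real.exp (-8 * ∑ x, s x) * Real.exp (-4 * ∑ x, ‖φ x‖ ^ 2) := by
  obtain ⟨c, hc, h⟩ := hJ.exists_dirichletForm_le hd Λ n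
  -- The constant comes from completing the square in `g u² + ν u - 8 u`, once per site.
  refine ⟨Real.exp (∑ _x : Λ, (8 - ν) ^ 2 / (4 * g)), Real.exp_pos _, fun s φ => ?_⟩
  rw [spinWeight_eq_exp, ← Real.exp_add, ← Real.exp_add, Real.exp_le_exp]
  -- Only the sign of the Dirichlet form matters here; the decay comes from the quartic potential.
  have h0 : dirichletForm J Λ φ ≤ 0 := by
    refine (h φ).trans ?_
    have : 0 ≤ c * ∑ x, ‖φ x‖ ^ 2 := by positivity
    linarith
  have h1 : ∀ x, 8 * (1 / 2 * ‖φ x‖ ^ 2 + s x) - (8 - ν) ^ 2 / (4 * g) ≤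
      potential g ν (s x) (1 / 2 * ‖φ x‖ ^ 2) := fun x => by
    rw [potential]
    set u := 1 / 2 * ‖φ x‖ ^ 2 + s x
    have : g * u ^ 2 + ν * u - (8 * u - (8 - ν) ^ 2 / (4 * g)) =
        (2 * g * u - (8 - ν)) ^ 2 / (4 * g) := by
      field_simp
      ring
    have h2 : 0 ≤ (2 * g * u - (8 - ν)) ^ 2 / (4 * g) := by positivity
    linarith
  have h2 := Finset.sum_le_sum fun x (_ : x ∈ Finset.univ) => h1 x
  simp only [Finset.sum_sub_distrib, mul_add, Finset.sum_add_distrib, ← Finset.mul_sum] at h2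
  linarith

theorem exists_abs_mul_spinWeight_le {J : Site d → ℝ} (hd : 1 ≤ d) (hJ : IsJumpRate J)
    {g : ℝ} (hg : 0 < g) (ν : ℝ) {p : SpinConfig Λ n → ℝ} {A : ℝ}
    (hA : ∀ φ, |p φ| ≤ A * Real.exp (3 * ∑ x, ‖φ x‖ ^ 2)) :
    ∃ C : ℝ, 0 ≤ C ∧ ∀ (s : Λ → ℝ) (φ : SpinConfig Λ n),
      ‖p φ * spinWeight J g ν s φ‖ ≤
        C * Real.exp (-8 * ∑ x, s x) * Real.exp (-1 * ∑ x, ‖φ x‖ ^ 2) := by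
  obtain ⟨C, hC, h⟩ := exists_spinWeight_le (Λ := Λ) (n := n) hd hJ hg ν
  have hA0 : 0 ≤ A := by
    have := (abs_nonneg _).trans (hA 0)
    exact nonneg_of_mul_nonneg_left this (Real.exp_pos _)
  refine ⟨A * C, by positivity, fun s φ => ?_⟩
  rw [norm_mul, Real.norm_eq_abs, Real.norm_eq_abs, abs_of_pos (spinWeight_pos J g ν s φ)]
  refine (mul_le_mul (hA φ) (h s φ) (spinWeight_pos J g ν s φ).le (by positivity)).trans_eq ?_
  have : Real.exp (3 * ∑ x, ‖φ x‖ ^ 2) * Real.exp (-4 * ∑ x, ‖φ x‖ ^ 2) =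
      Real.exp (-1 * ∑ x, ‖φ x‖ ^ 2) := by
    rw [← Real.exp_add]
    congr 1
    ring
  rw [← this]
  ring

theorem integrable_mul_spinWeight {J : Site d → ℝ} (hd : 1 ≤ d) (hJ : IsJumpRate J)
    {g : ℝ} (hg : 0 < g) (ν : ℝ) {p : SpinConfig Λ n → ℝ} {A : ℝ} (hp : Continuous p)
    (hA : ∀ φ, |p φ| ≤ A * Real.exp (3 * ∑ x, ‖φ x‖ ^ 2)) (s : Λ → ℝ) :
    Integrable fun φ => p φ * spinWeight J g ν s φ := by
  obtain ⟨C, -, h⟩ := exists_abs_mul_spinWeight_le hd hJ hg ν hA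
  refine ((integrable_exp_neg_sum_sq one_pos).const_mul (C * Real.exp (-8 * ∑ x, s x))).mono' ?_
    (Filter.Eventually.of_forall (h s))
  exact (hp.mul (continuous_spinWeight_right J g ν s)).aestronglyMeasurable

theorem exists_abs_integral_mul_spinWeight_le {J : Site d → ℝ} (hd : 1 ≤ d) (hJ : IsJumpRate J)
    {g : ℝ} (hg : 0 < g) (ν : ℝ) {p : SpinConfig Λ n → ℝ} {A : ℝ}
    (hA : ∀ φ, |p φ| ≤ A * Real.exp (3 * ∑ x, ‖φ x‖ ^ 2)) :
    ∃ D : ℝ, 0 ≤ D ∧ ∀ s : Λ → ℝ,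
      |∫ φ, p φ * spinWeight J g ν s φ| ≤ D * Real.exp (-8 * ∑ x, s x) := by
  obtain ⟨C, hC, h⟩ := exists_abs_mul_spinWeight_le hd hJ hg ν hA
  refine ⟨C * ∫ φ : SpinConfig Λ n, Real.exp (-1 * ∑ x, ‖φ x‖ ^ 2), ?_, fun s => ?_⟩
  · exact mul_nonneg hC (integral_nonneg fun _ => (Real.exp_pos _).le)
  · have := norm_integral_le_of_norm_le
      ((integrable_exp_neg_sum_sq one_pos).const_mul (C * Real.exp (-8 * ∑ x, s x)))
      (Filter.Eventually.of_forall (h s))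
    rw [integral_const_mul] at this
    rw [← Real.norm_eq_abs]
    linarith

theorem continuous_integral_mul_spinWeight {J : Site d → ℝ} (hd : 1 ≤ d) (hJ : IsJumpRate J)
    {g : ℝ} (hg : 0 < g) (ν : ℝ) {p : SpinConfig Λ n → ℝ} {A : ℝ} (hp : Continuous p)
    (hA : ∀ φ, |p φ| ≤ A * Real.exp (3 * ∑ x, ‖φ x‖ ^ 2)) :
    Continuous fun s : Λ → ℝ => ∫ φ, p φ * spinWeight J g ν s φ := by
  obtain ⟨C, hC, h⟩ := exists_abs_mul_spinWeight_le hd hJ hg ν hA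
  rw [continuous_iff_continuousAt]
  intro s₀
  -- The bound sees `s` only through its sum, so a local lower bound on the sum gives a dominating
  -- function.
  have hev : ∀ᶠ s : Λ → ℝ in nhds s₀, ∑ x, s₀ x - 1 < ∑ x, s x := by
    have : Continuous fun s : Λ → ℝ => ∑ x, s x := by fun_prop
    exact this.continuousAt.eventually (lt_mem_nhds (by linarith))
  refine continuousAt_of_dominated
    (bound := fun φ => C * Real.exp (-8 * (∑ x, s₀ x - 1)) * Real.exp (-1 * ∑ x, ‖φ x‖ ^ 2))
    (Filter.Eventually.of_forall fun s =>
      (integrable_mul_spinWeight hd hJ hg ν hp hA s).aestronglyMeasurable) ?_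
    ((integrable_exp_neg_sum_sq one_pos).const_mul _) (Filter.Eventually.of_forall fun φ => ?_)
  · filter_upwards [hev] with s hs
    refine Filter.Eventually.of_forall fun φ => (h s φ).trans ?_
    gcongr C * Real.exp ?_ * _
    linarith
  · exact (continuous_const.mul (continuous_spinWeight_left J g ν φ)).continuousAt

theorem hasDerivAt_spinWeight (J : Site d → ℝ) (g ν : ℝ) (s : Λ → ℝ) (x : Λ) (φ : SpinConfig Λ n)
    (r : ℝ) :
    HasDerivAt (fun r => spinWeight J g ν (s + Pi.single x r) φ)
      (-(2 * g * (1 / 2 * ‖φ x‖ ^ 2 + (s x + r)) + ν) *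
        spinWeight J g ν (s + Pi.single x r) φ) r := by
  have h1 : ∀ y, HasDerivAt
      (fun r => potential g ν ((s + Pi.single x r : Λ → ℝ) y) (1 / 2 * ‖φ y‖ ^ 2))
      (if y = x then 2 * g * (1 / 2 * ‖φ x‖ ^ 2 + (s x + r)) + ν else 0) r := by
    intro y
    by_cases e : y = x
    · subst e
      simp only [Pi.add_apply, Pi.single_eq_same, if_true, potential]
      have hu : HasDerivAt (fun r => 1 / 2 * ‖φ y‖ ^ 2 + (s y + r)) 1 r :=
        ((hasDerivAt_id r).const_add (s y)).const_add _
      refine ((hu.pow 2).const_mul g |>.add (hu.const_mul ν)).congr_deriv ?_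
      simp
      ring
    · simp only [Pi.add_apply, Pi.single_eq_of_ne e, if_neg e]
      exact hasDerivAt_const _ _
  have h2 := HasDerivAt.fun_sum fun y (_ : y ∈ Finset.univ) => h1 y
  simp only [Finset.sum_ite_eq', Finset.mem_univ, if_true] at h2
  simp only [spinWeight_eq_exp]
  refine (h2.const_sub (1 / 2 * dirichletForm J Λ φ)).exp.congr_deriv ?_
  ring

theorem one_add_le_exp_sum_sq (φ : SpinConfig Λ n) :
    1 + ∑ x, ‖φ x‖ ^ 2 ≤ Real.exp (∑ x, ‖φ x‖ ^ 2) := by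
  linarith [Real.add_one_le_exp (∑ x, ‖φ x‖ ^ 2)]

/-- Differentiation under the integral. The observable may grow only like one `exp (∑ |φ x|²)`,
since the derivative brings down a factor that costs another; both fit under the rate 4. -/
theorem hasDerivAt_integral_mul_spinWeight {J : Site d → ℝ} (hd : 1 ≤ d) (hJ : IsJumpRate J)
    {g : ℝ} (hg : 0 < g) (ν : ℝ) {p : SpinConfig Λ n → ℝ} {A : ℝ} (hp : Continuous p)
    (hA : ∀ φ, |p φ| ≤ A * Real.exp (∑ x, ‖φ x‖ ^ 2)) (s : Λ → ℝ) (x : Λ) (r : ℝ) :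
    HasDerivAt (fun r => ∫ φ, p φ * spinWeight J g ν (s + Pi.single x r) φ)
      (-∫ φ, p φ * ((2 * g * (1 / 2 * ‖φ x‖ ^ 2 + (s x + r)) + ν) *
        spinWeight J g ν (s + Pi.single x r) φ)) r := by
  have hA0 : 0 ≤ A := by
    have := (abs_nonneg _).trans (hA 0)
    exact nonneg_of_mul_nonneg_left this (Real.exp_pos _)
  have hA3 : ∀ φ, |p φ| ≤ A * Real.exp (3 * ∑ x, ‖φ x‖ ^ 2) := fun φ => by
    refine (hA φ).trans ?_
    have : 0 ≤ ∑ x, ‖φ x‖ ^ 2 := by positivity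
    gcongr
    linarith
  obtain ⟨C, hC, h⟩ := exists_spinWeight_le (Λ := Λ) (n := n) hd hJ hg ν
  -- `B (1 + ∑ |φ x|²)` bounds the factor brought down, uniformly for `r'` within distance 1 of `r`.
  let B : ℝ := 2 * g * (|s x| + |r| + 1) + |ν| + g
  have hB : 0 ≤ B := by positivity
  rw [← integral_neg]
  refine (hasDerivAt_integral_of_dominated_loc_of_deriv_le
    (F := fun r φ => p φ * spinWeight J g ν (s + Pi.single x r) φ)
    (F' := fun r φ => -(p φ * ((2 * g * (1 / 2 * ‖φ x‖ ^ 2 + (s x + r)) + ν) *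
        spinWeight J g ν (s + Pi.single x r) φ)))
    (bound := fun φ => A * B * C * Real.exp (-8 * (∑ x, s x - |r| - 1)) *
      Real.exp (-1 * ∑ x, ‖φ x‖ ^ 2))
    (Metric.ball_mem_nhds r one_pos)
    (Filter.Eventually.of_forall fun r =>
      (integrable_mul_spinWeight hd hJ hg ν hp hA3 _).aestronglyMeasurable)
    (integrable_mul_spinWeight hd hJ hg ν hp hA3 _) ?_ ?_
    ((integrable_exp_neg_sum_sq one_pos).const_mul _) ?_).2
  · have : Continuous fun φ : SpinConfig Λ n => spinWeight J g ν (s + Pi.single x r) φ :=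
      continuous_spinWeight_right J g ν _
    refine Continuous.aestronglyMeasurable (hp.mul (Continuous.mul ?_ this)).neg
    fun_prop
  · refine Filter.Eventually.of_forall fun φ r' hr' => ?_
    have hr'' : |r'| ≤ |r| + 1 := by
      have h1 := Metric.mem_ball.mp hr'
      rw [Real.dist_eq] at h1
      have h2 := abs_sub_abs_le_abs_sub r' r
      linarith
    have hQ : 0 ≤ ∑ x, ‖φ x‖ ^ 2 := by positivity
    have hxQ : ‖φ x‖ ^ 2 ≤ ∑ x, ‖φ x‖ ^ 2 :=
      Finset.single_le_sum (f := fun x => ‖φ x‖ ^ 2) (fun _ _ => sq_nonneg _) (Finset.mem_univ x)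
    have hfac : |2 * g * (1 / 2 * ‖φ x‖ ^ 2 + (s x + r')) + ν| ≤
        B * Real.exp (∑ x, ‖φ x‖ ^ 2) := by
      have e0 : |2 * g * (1 / 2 * ‖φ x‖ ^ 2 + (s x + r')) + ν| ≤
          g * ‖φ x‖ ^ 2 + 2 * g * (|s x| + |r'|) + |ν| := by
        rw [abs_le]
        have h1 := abs_le.mp (le_refl |s x|)
        have h2 := abs_le.mp (le_refl |r'|)
        have h3 := abs_le.mp (le_refl |ν|)
        have h4 : 0 ≤ g * ‖φ x‖ ^ 2 := by positivity
        have h5 := mul_le_mul_of_nonneg_left h1.1 hg.le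
        have h6 := mul_le_mul_of_nonneg_left h1.2 hg.le
        have h7 := mul_le_mul_of_nonneg_left h2.1 hg.le
        have h8 := mul_le_mul_of_nonneg_left h2.2 hg.le
        constructor <;> linarith
      have e1 : g * ‖φ x‖ ^ 2 + 2 * g * (|s x| + |r'|) + |ν| ≤
          B * (1 + ∑ x, ‖φ x‖ ^ 2) := by
        have h1 : g * ‖φ x‖ ^ 2 ≤ g * ∑ x, ‖φ x‖ ^ 2 := by gcongr
        have h2 : g * |r'| ≤ g * (|r| + 1) := by gcongr
        have h3 : g * ∑ x, ‖φ x‖ ^ 2 ≤ B * ∑ x, ‖φ x‖ ^ 2 := by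
          refine mul_le_mul_of_nonneg_right ?_ hQ
          have : 0 ≤ 2 * g * (|s x| + |r| + 1) + |ν| := by positivity
          simp only [B]
          linarith
        have h4 : 2 * g * (|s x| + |r'|) + |ν| ≤ B := by
          simp only [B]
          linarith
        linarith
      exact e0.trans (e1.trans (mul_le_mul_of_nonneg_left (one_add_le_exp_sum_sq φ) hB))
    have hw : spinWeight J g ν (s + Pi.single x r') φ ≤
        C * Real.exp (-8 * (∑ x, s x - |r| - 1)) * Real.exp (-4 * ∑ x, ‖φ x‖ ^ 2) := by
      refine (h _ φ).trans ?_
      have : ∑ y, (s + Pi.single x r' : Λ → ℝ) y = ∑ y, s y + r' := by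
        simp [Finset.sum_add_distrib]
      rw [this]
      have := neg_abs_le r'
      gcongr C * Real.exp ?_ * _
      linarith
    rw [norm_neg, norm_mul, norm_mul, Real.norm_eq_abs, Real.norm_eq_abs, Real.norm_eq_abs,
      abs_of_pos (spinWeight_pos _ _ _ _ _)]
    have hprod := mul_le_mul (hA φ) (mul_le_mul hfac hw (spinWeight_pos _ _ _ _ _).le
      (by positivity)) (mul_nonneg (abs_nonneg _) (spinWeight_pos _ _ _ _ _).le)
      (by positivity)
    refine hprod.trans ?_
    have e : Real.exp (∑ x, ‖φ x‖ ^ 2) * (Real.exp (∑ x, ‖φ x‖ ^ 2) *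
        Real.exp (-4 * ∑ x, ‖φ x‖ ^ 2)) ≤ Real.exp (-1 * ∑ x, ‖φ x‖ ^ 2) := by
      rw [← Real.exp_add, ← Real.exp_add, Real.exp_le_exp]
      linarith
    have := mul_le_mul_of_nonneg_left e
      (by positivity : 0 ≤ A * B * C * Real.exp (-8 * (∑ x, s x - |r| - 1)))
    linarith
  · refine Filter.Eventually.of_forall fun φ r' _ => ?_
    refine ((hasDerivAt_spinWeight J g ν s x φ r').const_mul (p φ)).congr_deriv ?_
    ring

end SpinIntegrals

/-! ### Integration by parts and the evolution of the two-point function -/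

section TwoPoint

variable {d : ℕ} {Λ : Finset (Site d)} {n : ℕ}

/-- The configuration that is the `i`-th unit vector at `x` and zero elsewhere. -/
noncomputable def unitSpin (x : Λ) (i : Fin n) : SpinConfig Λ n :=
  Pi.single x (EuclideanSpace.single i 1)

theorem unitSpin_apply (x y : Λ) (i j : Fin n) :
    unitSpin x i y j = if y = x then (if j = i then 1 else 0) else 0 := by
  unfold unitSpin
  by_cases h : y = x
  · subst h
    simp
  · simp [h]

theorem hasDerivAt_add_smul_unitSpin (φ : SpinConfig Λ n) (x y : Λ) (i j : Fin n) :
    HasDerivAt (fun t : ℝ => (φ + t • unitSpin x i) y j) (unitSpin x i y j) 0 := by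
  have : (fun t : ℝ => (φ + t • unitSpin x i) y j) =
      fun t => φ y j + t * unitSpin x i y j := by
    funext t
    simp
  rw [this]
  simpa using ((hasDerivAt_id (0 : ℝ)).mul_const (unitSpin x i y j)).const_add (φ y j)

theorem IsJumpRate.laplacian_symm {J : Site d → ℝ} (hJ : IsJumpRate J) (x y : Λ) :
    laplacian J Λ x y = laplacian J Λ y x := by
  rw [laplacian, laplacian, ← hJ.neg_apply, neg_sub]

theorem IsJumpRate.hasLineDerivAt_dirichletForm {J : Site d → ℝ} (hJ : IsJumpRate J)
    (φ : SpinConfig Λ n) (x : Λ) (i : Fin n) :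
    HasLineDerivAt ℝ (dirichletForm J Λ) (2 * ∑ y, laplacian J Λ x y * φ y i) φ
      (unitSpin x i) := by
  have h := HasDerivAt.fun_sum fun (y : Λ) (_ : y ∈ Finset.univ) =>
    HasDerivAt.fun_sum fun (j : Fin n) (_ : j ∈ Finset.univ) =>
      (hasDerivAt_add_smul_unitSpin φ x y i j).fun_mul
        (HasDerivAt.fun_sum fun (z : Λ) (_ : z ∈ Finset.univ) =>
          (hasDerivAt_add_smul_unitSpin φ x z i j).const_mul (laplacian J Λ y z))
  refine HasDerivAt.congr_deriv h ?_
  simp only [unitSpin_apply, zero_smul, add_zero, Finset.sum_add_distrib, mul_ite, mul_one,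
    mul_zero, ite_mul, one_mul, zero_mul, Finset.sum_ite_eq', Finset.mem_univ, if_true,
    Finset.sum_ite_irrel, Finset.sum_const_zero]
  rw [two_mul]
  congr 1
  refine Finset.sum_congr rfl fun y _ => ?_
  rw [hJ.laplacian_symm, mul_comm]

theorem hasLineDerivAt_norm_sq (φ : SpinConfig Λ n) (x y : Λ) (i : Fin n) :
    HasLineDerivAt ℝ (fun φ : SpinConfig Λ n => ‖φ y‖ ^ 2) (if y = x then 2 * φ x i else 0) φ
      (unitSpin x i) := by
  simp only [EuclideanSpace.real_norm_sq_eq]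
  have h := HasDerivAt.fun_sum fun (j : Fin n) (_ : j ∈ Finset.univ) =>
    (hasDerivAt_add_smul_unitSpin φ x y i j).fun_pow 2
  refine HasDerivAt.congr_deriv h ?_
  by_cases e : y = x
  · subst e
    simp [unitSpin_apply]
  · simp [unitSpin_apply, e]

/-- The potential contributes `φ x i` times the very factor produced by differentiating in `s x`.
This match turns integration by parts into an equation in the background field. -/
theorem IsJumpRate.hasLineDerivAt_spinWeight {J : Site d → ℝ} (hJ : IsJumpRate J) (g ν : ℝ)
    (s : Λ → ℝ) (φ : SpinConfig Λ n) (x : Λ) (i : Fin n) :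
    HasLineDerivAt ℝ (spinWeight J g ν s)
      ((∑ y, laplacian J Λ x y * φ y i -
        (2 * g * (1 / 2 * ‖φ x‖ ^ 2 + s x) + ν) * φ x i) * spinWeight J g ν s φ) φ
      (unitSpin x i) := by
  have h1 : ∀ y, HasDerivAt
      (fun t : ℝ => potential g ν (s y) (1 / 2 * ‖(φ + t • unitSpin x i) y‖ ^ 2))
      (if y = x then (2 * g * (1 / 2 * ‖φ x‖ ^ 2 + s x) + ν) * φ x i else 0) 0 := by
    intro y
    have hy : HasDerivAt (fun t : ℝ => ‖(φ + t • unitSpin x i) y‖ ^ 2)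
      (if y = x then 2 * φ x i else 0) 0 := hasLineDerivAt_norm_sq φ x y i
    have hu := (hy.const_mul (1 / 2)).add_const (s y)
    refine (((hu.fun_pow 2).const_mul g).fun_add (hu.const_mul ν)).congr_deriv ?_
    by_cases e : y = x
    · subst e
      simp
      ring
    · simp [e]
  have h2 := HasDerivAt.fun_sum fun y (_ : y ∈ Finset.univ) => h1 y
  simp only [Finset.sum_ite_eq', Finset.mem_univ, if_true] at h2
  have h3 : HasDerivAt (fun t : ℝ => dirichletForm J Λ (φ + t • unitSpin x i))
    (2 * ∑ y, laplacian J Λ x y * φ y i) 0 := hJ.hasLineDerivAt_dirichletForm φ x i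
  have h4 := ((h3.const_mul (1 / 2)).fun_sub h2).exp
  unfold HasLineDerivAt
  simp only [spinWeight_eq_exp]
  refine h4.congr_deriv ?_
  simp only [zero_smul, add_zero]
  ring

theorem norm_sq_le_sum (φ : SpinConfig Λ n) (x : Λ) : ‖φ x‖ ^ 2 ≤ ∑ x, ‖φ x‖ ^ 2 :=
  Finset.single_le_sum (f := fun x => ‖φ x‖ ^ 2) (fun _ _ => sq_nonneg _) (Finset.mem_univ x)

theorem norm_mul_norm_le_exp (φ : SpinConfig Λ n) (x y : Λ) :
    ‖φ x‖ * ‖φ y‖ ≤ Real.exp (∑ x, ‖φ x‖ ^ 2) := by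
  have := norm_sq_le_sum φ x
  have := norm_sq_le_sum φ y
  have := one_add_le_exp_sum_sq φ
  nlinarith [sq_nonneg (‖φ x‖ - ‖φ y‖)]

theorem norm_le_exp (φ : SpinConfig Λ n) (x : Λ) :
    ‖φ x‖ ≤ Real.exp (∑ x, ‖φ x‖ ^ 2) := by
  have := norm_sq_le_sum φ x
  have := one_add_le_exp_sum_sq φ
  nlinarith [sq_nonneg (‖φ x‖ - 1)]

theorem abs_coord_le (v : EuclideanSpace ℝ (Fin n)) (i : Fin n) : |v i| ≤ ‖v‖ := by
  rw [← Real.norm_eq_abs]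
  exact PiLp.norm_apply_le v i

theorem exp_sum_sq_le_exp_three (φ : SpinConfig Λ n) :
    Real.exp (∑ x, ‖φ x‖ ^ 2) ≤ Real.exp (3 * ∑ x, ‖φ x‖ ^ 2) := by
  rw [Real.exp_le_exp]
  have : 0 ≤ ∑ x, ‖φ x‖ ^ 2 := by positivity
  linarith

theorem exp_two_sum_sq_le_exp_three (φ : SpinConfig Λ n) :
    Real.exp (∑ x, ‖φ x‖ ^ 2) * Real.exp (∑ x, ‖φ x‖ ^ 2) ≤
      Real.exp (3 * ∑ x, ‖φ x‖ ^ 2) := by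
  rw [← Real.exp_add, Real.exp_le_exp]
  have : 0 ≤ ∑ x, ‖φ x‖ ^ 2 := by positivity
  linarith

theorem integrable_coord_mul_spinWeight {J : Site d → ℝ} (hd : 1 ≤ d) (hJ : IsJumpRate J)
    {g : ℝ} (hg : 0 < g) (ν : ℝ) (s : Λ → ℝ) (x : Λ) (i : Fin n) :
    Integrable fun φ : SpinConfig Λ n => φ x i * spinWeight J g ν s φ :=
  integrable_mul_spinWeight hd hJ hg ν (A := 1) (by fun_prop) (fun φ => by
    rw [one_mul]
    exact (abs_coord_le _ _).trans ((norm_le_exp φ x).trans (exp_sum_sq_le_exp_three φ))) s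

theorem integrable_coord_mul_coord_mul_spinWeight {J : Site d → ℝ} (hd : 1 ≤ d)
    (hJ : IsJumpRate J) {g : ℝ} (hg : 0 < g) (ν : ℝ) (s : Λ → ℝ) (x y : Λ) (i : Fin n) :
    Integrable fun φ : SpinConfig Λ n => φ x i * φ y i * spinWeight J g ν s φ :=
  integrable_mul_spinWeight hd hJ hg ν (A := 1) (by fun_prop) (fun φ => by
    rw [one_mul, abs_mul]
    exact (mul_le_mul (abs_coord_le _ _) (abs_coord_le _ _) (abs_nonneg _)
      (norm_nonneg _)).trans ((norm_mul_norm_le_exp φ x y).trans (exp_sum_sq_le_exp_three φ))) s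

theorem integrable_force_mul_spinWeight {J : Site d → ℝ} (hd : 1 ≤ d)
    (hJ : IsJumpRate J) {g : ℝ} (hg : 0 < g) (ν : ℝ) (s : Λ → ℝ) (x y : Λ) (i : Fin n) :
    Integrable fun φ : SpinConfig Λ n =>
      φ x i * φ y i * (2 * g * (1 / 2 * ‖φ y‖ ^ 2 + s y) + ν) * spinWeight J g ν s φ :=
  integrable_mul_spinWeight hd hJ hg ν (A := g + |2 * g * s y + ν|) (by fun_prop) (fun φ => by
    rw [abs_mul, abs_mul]
    have h1 : |φ x i| * |φ y i| ≤ Real.exp (∑ x, ‖φ x‖ ^ 2) :=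
      (mul_le_mul (abs_coord_le _ _) (abs_coord_le _ _) (abs_nonneg _)
        (norm_nonneg _)).trans (norm_mul_norm_le_exp φ x y)
    have h2 : |2 * g * (1 / 2 * ‖φ y‖ ^ 2 + s y) + ν| ≤
        (g + |2 * g * s y + ν|) * Real.exp (∑ x, ‖φ x‖ ^ 2) := by
      have e : 2 * g * (1 / 2 * ‖φ y‖ ^ 2 + s y) + ν = g * ‖φ y‖ ^ 2 + (2 * g * s y + ν) := by
        ring
      have hy := norm_sq_le_sum φ y
      have hE := one_add_le_exp_sum_sq φ
      have hQ : 0 ≤ ∑ x, ‖φ x‖ ^ 2 := by positivity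
      rw [e]
      refine (abs_add_le _ _).trans ?_
      rw [abs_of_nonneg (by positivity : 0 ≤ g * ‖φ y‖ ^ 2), add_mul]
      refine add_le_add (mul_le_mul_of_nonneg_left (by linarith) hg.le) ?_
      exact le_mul_of_one_le_right (abs_nonneg _) (by linarith)
    refine (mul_le_mul h1 h2 (abs_nonneg _) (Real.exp_pos _).le).trans ?_
    have := mul_le_mul_of_nonneg_left (exp_two_sum_sq_le_exp_three φ)
      (by positivity : 0 ≤ g + |2 * g * s y + ν|)
    linarith) s

theorem one_le_exp_three (φ : SpinConfig Λ n) :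
    |(1 : ℝ)| ≤ 1 * Real.exp (3 * ∑ x, ‖φ x‖ ^ 2) := by
  rw [abs_one, one_mul]
  exact Real.one_le_exp (by positivity)

theorem integrable_spinWeight {J : Site d → ℝ} (hd : 1 ≤ d) (hJ : IsJumpRate J)
    {g : ℝ} (hg : 0 < g) (ν : ℝ) (s : Λ → ℝ) :
    Integrable fun φ : SpinConfig Λ n => spinWeight J g ν s φ := by
  simpa using integrable_mul_spinWeight (n := n) hd hJ hg ν continuous_const one_le_exp_three s

/-- The unnormalised partition function `∫ dφ exp (½ (φ, Δ φ)) ∏ₓ exp (-V_{sₓ}(½ |φₓ|²))`. -/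
noncomputable def partitionFn (J : Site d → ℝ) (n : ℕ) (g ν : ℝ) (s : Λ → ℝ) : ℝ :=
  ∫ φ : SpinConfig Λ n, spinWeight J g ν s φ

/-- The unnormalised two-point function, divided by the number of components. -/
noncomputable def twoPoint (J : Site d → ℝ) (n : ℕ) (g ν : ℝ) (b : Λ) (s : Λ → ℝ) (x : Λ) : ℝ :=
  1 / n * ∫ φ : SpinConfig Λ n, inner ℝ (φ x) (φ b) * spinWeight J g ν s φ

theorem inner_eq_sum (v w : EuclideanSpace ℝ (Fin n)) : inner ℝ v w = ∑ i, v i * w i := by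
  simp [PiLp.inner_apply, mul_comm]

/-- The integral of the derivative of `φ b i` times the weight along `unitSpin x i` vanishes. The
derivative of `φ b i` gives the source at `x = b`; that of the weight gives the Laplacian and the
force. -/
theorem integration_by_parts_coord {J : Site d → ℝ} (hd : 1 ≤ d) (hJ : IsJumpRate J)
    {g : ℝ} (hg : 0 < g) (ν : ℝ) (s : Λ → ℝ) (x b : Λ) (i : Fin n) :
    ∑ y, laplacian J Λ x y * ∫ φ : SpinConfig Λ n, φ b i * φ y i * spinWeight J g ν s φ =
      (∫ φ : SpinConfig Λ n,
        φ b i * φ x i * (2 * g * (1 / 2 * ‖φ x‖ ^ 2 + s x) + ν) * spinWeight J g ν s φ) -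
      if x = b then partitionFn J n g ν s else 0 := by
  have hint : Integrable fun φ : SpinConfig Λ n =>
      ∑ y, laplacian J Λ x y * (φ b i * φ y i * spinWeight J g ν s φ) :=
    integrable_finsetSum _ fun y _ =>
      (integrable_coord_mul_coord_mul_spinWeight hd hJ hg ν s b y i).const_mul _
  have hint1 := integrable_force_mul_spinWeight hd hJ hg ν s b x i
  have hw := integrable_spinWeight (n := n) hd hJ hg ν s
  have hprod : (fun φ : SpinConfig Λ n => φ b i *
      ((∑ y, laplacian J Λ x y * φ y i -
        (2 * g * (1 / 2 * ‖φ x‖ ^ 2 + s x) + ν) * φ x i) * spinWeight J g ν s φ)) =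
      fun φ => (∑ y, laplacian J Λ x y * (φ b i * φ y i * spinWeight J g ν s φ)) -
        φ b i * φ x i * (2 * g * (1 / 2 * ‖φ x‖ ^ 2 + s x) + ν) * spinWeight J g ν s φ := by
    funext φ
    have : ∑ y, laplacian J Λ x y * (φ b i * φ y i * spinWeight J g ν s φ) =
        φ b i * (∑ y, laplacian J Λ x y * φ y i) * spinWeight J g ν s φ := by
      rw [Finset.mul_sum, Finset.sum_mul]
      exact Finset.sum_congr rfl fun y _ => by ring
    rw [this]
    ring
  have hibp := integral_bilinear_hasLineDerivAt_right_eq_neg_left_of_integrable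
    (μ := (volume : Measure (SpinConfig Λ n))) (B := ContinuousLinearMap.mul ℝ ℝ)
    (f := fun φ => φ b i) (f' := fun _ => if b = x then 1 else 0)
    (g := spinWeight J g ν s) (v := unitSpin x i)
    (g' := fun φ => (∑ y, laplacian J Λ x y * φ y i -
        (2 * g * (1 / 2 * ‖φ x‖ ^ 2 + s x) + ν) * φ x i) * spinWeight J g ν s φ)
    (by
      simp only [ContinuousLinearMap.mul_apply']
      exact hw.const_mul _)
    (by
      simp only [ContinuousLinearMap.mul_apply']
      rw [hprod]
      exact hint.sub hint1)
    (by simpa using integrable_coord_mul_spinWeight hd hJ hg ν s b i)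
    (fun φ _ => by
      refine (hasDerivAt_add_smul_unitSpin φ x b i i).congr_deriv ?_
      simp [unitSpin_apply])
    (fun φ _ => hJ.hasLineDerivAt_spinWeight g ν s φ x i)
  simp only [ContinuousLinearMap.mul_apply'] at hibp
  rw [hprod, integral_sub hint hint1, integral_const_mul, integral_finsetSum _ fun y _ =>
      (integrable_coord_mul_coord_mul_spinWeight hd hJ hg ν s b y i).const_mul _] at hibp
  simp only [integral_const_mul] at hibp
  have hite : (if b = x then (1 : ℝ) else 0) * ∫ φ : SpinConfig Λ n, spinWeight J g ν s φ =
      if x = b then partitionFn J n g ν s else 0 := by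
    simp only [partitionFn, eq_comm (a := b), ite_mul, one_mul, zero_mul]
  rw [hite] at hibp
  linarith

theorem continuous_inner_spin (x b : Λ) :
    Continuous fun φ : SpinConfig Λ n => (inner ℝ (φ x) (φ b) : ℝ) := by
  fun_prop

theorem abs_inner_spin_le (φ : SpinConfig Λ n) (x b : Λ) :
    |(inner ℝ (φ x) (φ b) : ℝ)| ≤ 1 * Real.exp (∑ x, ‖φ x‖ ^ 2) := by
  rw [one_mul]
  exact (abs_real_inner_le_norm _ _).trans (norm_mul_norm_le_exp φ x b)

theorem integrable_inner_mul_spinWeight {J : Site d → ℝ} (hd : 1 ≤ d) (hJ : IsJumpRate J)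
    {g : ℝ} (hg : 0 < g) (ν : ℝ) (s : Λ → ℝ) (x b : Λ) :
    Integrable fun φ : SpinConfig Λ n => inner ℝ (φ x) (φ b) * spinWeight J g ν s φ :=
  integrable_mul_spinWeight hd hJ hg ν (A := 1) (continuous_inner_spin x b) (fun φ =>
    (abs_inner_spin_le φ x b).trans (by
      simpa using exp_sum_sq_le_exp_three φ)) s

theorem integral_inner_mul_spinWeight {J : Site d → ℝ} (hd : 1 ≤ d) (hJ : IsJumpRate J)
    {g : ℝ} (hg : 0 < g) (ν : ℝ) (s : Λ → ℝ) (x b : Λ) :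
    ∫ φ : SpinConfig Λ n, inner ℝ (φ x) (φ b) * spinWeight J g ν s φ =
      ∑ i, ∫ φ : SpinConfig Λ n, φ b i * φ x i * spinWeight J g ν s φ := by
  rw [← integral_finsetSum _ fun i _ =>
    integrable_coord_mul_coord_mul_spinWeight hd hJ hg ν s b x i]
  refine integral_congr_ae (Filter.Eventually.of_forall fun φ => ?_)
  simp only [inner_eq_sum, Finset.sum_mul]
  exact Finset.sum_congr rfl fun i _ => by ring

/-- Summed over components, the source appears `n` times, which is why `twoPoint` carries the factor
`1 / n`. -/
theorem integration_by_parts {J : Site d → ℝ} (hd : 1 ≤ d) (hJ : IsJumpRate J)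
    {g : ℝ} (hg : 0 < g) (ν : ℝ) (s : Λ → ℝ) (x b : Λ) :
    ∫ φ : SpinConfig Λ n, inner ℝ (φ x) (φ b) *
      ((2 * g * (1 / 2 * ‖φ x‖ ^ 2 + s x) + ν) * spinWeight J g ν s φ) =
      (∑ y, laplacian J Λ x y *
        ∫ φ : SpinConfig Λ n, inner ℝ (φ y) (φ b) * spinWeight J g ν s φ) +
      n * if x = b then partitionFn J n g ν s else 0 := by
  have hforce : ∫ φ : SpinConfig Λ n, inner ℝ (φ x) (φ b) *
      ((2 * g * (1 / 2 * ‖φ x‖ ^ 2 + s x) + ν) * spinWeight J g ν s φ) =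
      ∑ i, ∫ φ : SpinConfig Λ n, φ b i * φ x i *
        (2 * g * (1 / 2 * ‖φ x‖ ^ 2 + s x) + ν) * spinWeight J g ν s φ := by
    rw [← integral_finsetSum _ fun i _ => integrable_force_mul_spinWeight hd hJ hg ν s b x i]
    refine integral_congr_ae (Filter.Eventually.of_forall fun φ => ?_)
    simp only [inner_eq_sum, Finset.sum_mul]
    exact Finset.sum_congr rfl fun i _ => by ring
  have hsum : ∀ i : Fin n, ∫ φ : SpinConfig Λ n, φ b i * φ x i *
        (2 * g * (1 / 2 * ‖φ x‖ ^ 2 + s x) + ν) * spinWeight J g ν s φ =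
      (∑ y, laplacian J Λ x y * ∫ φ : SpinConfig Λ n, φ b i * φ y i * spinWeight J g ν s φ) +
      if x = b then partitionFn J n g ν s else 0 := fun i => by
    rw [integration_by_parts_coord hd hJ hg ν s x b i]
    ring
  rw [hforce, Finset.sum_congr rfl fun i _ => hsum i, Finset.sum_add_distrib, Finset.sum_comm,
    Finset.sum_const, Finset.card_univ, Fintype.card_fin, nsmul_eq_mul]
  congr 1
  refine Finset.sum_congr rfl fun y _ => ?_
  rw [integral_inner_mul_spinWeight hd hJ hg ν, Finset.mul_sum]

/-- Integration by parts, as an evolution equation for the two-point function. -/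
theorem hasDerivAt_twoPoint {J : Site d → ℝ} (hd : 1 ≤ d) (hJ : IsJumpRate J) (hn : 1 ≤ n)
    {g : ℝ} (hg : 0 < g) (ν : ℝ) (s : Λ → ℝ) (x b : Λ) (r : ℝ) :
    HasDerivAt (fun r => twoPoint J n g ν b (s + Pi.single x r) x)
      (-(∑ y, laplacian J Λ x y * twoPoint J n g ν b (s + Pi.single x r) y) -
        if x = b then partitionFn J n g ν (s + Pi.single x r) else 0) r := by
  have hn0 : (n : ℝ) ≠ 0 := by positivity
  have h := hasDerivAt_integral_mul_spinWeight (n := n) hd hJ hg ν (A := 1)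
    (continuous_inner_spin x b) (fun φ => abs_inner_spin_le φ x b) s x r
  have hs : s x + r = (s + Pi.single x r : Λ → ℝ) x := by simp
  rw [hs, integration_by_parts hd hJ hg ν] at h
  refine (h.const_mul (1 / (n : ℝ))).congr_deriv ?_
  have hK : ∑ y, laplacian J Λ x y * twoPoint J n g ν b (s + Pi.single x r) y =
      1 / (n : ℝ) * ∑ y, laplacian J Λ x y * ∫ φ : SpinConfig Λ n,
        inner ℝ (φ y) (φ b) * spinWeight J g ν (s + Pi.single x r) φ := by
    rw [Finset.mul_sum]
    exact Finset.sum_congr rfl fun y _ => by rw [twoPoint]; ring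
  rw [hK]
  field_simp
  ring

theorem continuous_twoPoint {J : Site d → ℝ} (hd : 1 ≤ d) (hJ : IsJumpRate J)
    {g : ℝ} (hg : 0 < g) (ν : ℝ) (x b : Λ) :
    Continuous fun s : Λ → ℝ => twoPoint J n g ν b s x :=
  continuous_const.mul (continuous_integral_mul_spinWeight hd hJ hg ν (A := 1)
    (continuous_inner_spin x b) fun φ => (abs_inner_spin_le φ x b).trans (by
      simpa using exp_sum_sq_le_exp_three φ))

theorem exists_abs_twoPoint_le {J : Site d → ℝ} (hd : 1 ≤ d) (hJ : IsJumpRate J)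
    {g : ℝ} (hg : 0 < g) (ν : ℝ) (b : Λ) :
    ∃ D : ℝ, 0 ≤ D ∧ ∀ (s : Λ → ℝ) (x : Λ),
      |twoPoint J n g ν b s x| ≤ D * Real.exp (-8 * ∑ x, s x) := by
  choose D hD h using fun x : Λ =>
    exists_abs_integral_mul_spinWeight_le (n := n) hd hJ hg ν (A := 1)
    (p := fun φ => inner ℝ (φ x) (φ b)) fun φ => (abs_inner_spin_le φ x b).trans (by
      simpa using exp_sum_sq_le_exp_three φ)
  refine ⟨|1 / (n : ℝ)| * ∑ x, D x,
    mul_nonneg (abs_nonneg _) (Finset.sum_nonneg fun x _ => hD x), fun s x => ?_⟩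
  rw [twoPoint, abs_mul, mul_assoc]
  refine mul_le_mul_of_nonneg_left ((h x s).trans ?_) (abs_nonneg _)
  exact mul_le_mul_of_nonneg_right
    (Finset.single_le_sum (fun x _ => hD x) (Finset.mem_univ x)) (Real.exp_pos _).le

theorem partitionFn_pos {J : Site d → ℝ} (hd : 1 ≤ d) (hJ : IsJumpRate J)
    {g : ℝ} (hg : 0 < g) (ν : ℝ) (s : Λ → ℝ) : 0 < partitionFn J n g ν s := by
  have h := integrable_spinWeight (n := n) hd hJ hg ν s
  unfold partitionFn
  simp only [spinWeight_eq_exp] at h ⊢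
  exact integral_exp_pos h

theorem continuous_partitionFn {J : Site d → ℝ} (hd : 1 ≤ d) (hJ : IsJumpRate J)
    {g : ℝ} (hg : 0 < g) (ν : ℝ) :
    Continuous fun s : Λ → ℝ => partitionFn J n g ν s := by
  simpa [partitionFn] using continuous_integral_mul_spinWeight (n := n) hd hJ hg ν
    continuous_const one_le_exp_three

theorem exists_partitionFn_le {J : Site d → ℝ} (hd : 1 ≤ d) (hJ : IsJumpRate J)
    {g : ℝ} (hg : 0 < g) (ν : ℝ) :
    ∃ D : ℝ, 0 ≤ D ∧ ∀ s : Λ → ℝ,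
      partitionFn J n g ν s ≤ D * Real.exp (-8 * ∑ x, s x) := by
  obtain ⟨D, hD, h⟩ := exists_abs_integral_mul_spinWeight_le (n := n) hd hJ hg ν
    (Λ := Λ) (p := fun _ => 1) one_le_exp_three
  refine ⟨D, hD, fun s => ?_⟩
  simpa [partitionFn] using (le_abs_self _).trans (h s)

end TwoPoint

/-! ### One step of the killed jump chain -/

section OneStep

theorem integral_expMeasure {q : ℝ} (hq : 0 < q) (f : ℝ → ℝ) :
    ∫ r, f r ∂expMeasure q = ∫ r in Set.Ioi 0, q * Real.exp (-(q * r)) * f r := by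
  have h1 : ∫ r, f r ∂expMeasure q = ∫ r, (exponentialPDF q r).toReal • f r :=
    integral_withDensity_eq_integral_toReal_smul
      (measurable_exponentialPDFReal q).ennreal_ofReal
      (Filter.Eventually.of_forall fun _ => ENNReal.ofReal_lt_top) f
  rw [h1, ← integral_Ici_eq_integral_Ioi, ← integral_indicator measurableSet_Ici]
  refine integral_congr_ae (Filter.Eventually.of_forall fun r => ?_)
  simp only [exponentialPDF_eq, smul_eq_mul, Set.indicator, Set.mem_Ici]
  split_ifs with h
  · rw [ENNReal.toReal_ofReal (by positivity)]
  · simp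

theorem ae_pos_expMeasure (q : ℝ) : ∀ᵐ r ∂expMeasure q, 0 < r := by
  have h : expMeasure q (Set.Iic 0) = 0 := by
    change (volume.withDensity (exponentialPDF q)) (Set.Iic 0) = 0
    rw [withDensity_apply _ measurableSet_Iic, ← setLIntegral_congr Iio_ae_eq_Iic]
    exact lintegral_gammaPDF_of_nonpos le_rfl
  rw [ae_iff]
  simp only [not_lt]
  exact h

/-- Variation of constants for `k' = q (k - p) - z`, with the solution that stays bounded. -/
theorem eq_integral_expMeasure_of_hasDerivAt {q D : ℝ} (hq : 0 < q) {k z p : ℝ → ℝ}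
    (hk : ∀ r, HasDerivAt k (q * (k r - p r) - z r) r) (hz : Continuous z) (hp : Continuous p)
    (hkD : ∀ r, 0 ≤ r → |k r| ≤ D) (hpD : ∀ r, 0 ≤ r → |p r| ≤ D)
    (hzD : ∀ r, 0 ≤ r → |∫ ρ in (0)..r, z ρ| ≤ D) :
    k 0 = ∫ r, ((∫ ρ in (0)..r, z ρ) + p r) ∂expMeasure q := by
  have hzi : ∀ r, HasDerivAt (fun r => ∫ ρ in (0)..r, z ρ) (z r) r := fun r =>
    intervalIntegral.integral_hasDerivAt_right (hz.intervalIntegrable _ _)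
      (hz.stronglyMeasurableAtFilter _ _) hz.continuousAt
  have hzc : Continuous fun r => ∫ ρ in (0)..r, z ρ :=
    continuous_iff_continuousAt.mpr fun r => (hzi r).continuousAt
  -- The integrating factor removes `k` from the derivative of `u`. Then `u 0 = k 0`, and
  -- boundedness of `k` forces `u` to vanish at infinity, which selects the right solution.
  let u : ℝ → ℝ := fun r => Real.exp (-(q * r)) * (k r + ∫ ρ in (0)..r, z ρ)
  have hu : ∀ r, HasDerivAt u
      (-(q * Real.exp (-(q * r)) * ((∫ ρ in (0)..r, z ρ) + p r))) r := by
    intro r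
    have he : HasDerivAt (fun r => Real.exp (-(q * r))) (Real.exp (-(q * r)) * -(q * 1)) r :=
      ((hasDerivAt_id r).const_mul q).fun_neg.exp
    refine (he.fun_mul ((hk r).fun_add (hzi r))).congr_deriv ?_
    ring
  have hexp : Filter.Tendsto (fun r => Real.exp (-(q * r))) Filter.atTop (nhds 0) :=
    Real.tendsto_exp_neg_atTop_nhds_zero.comp (Filter.tendsto_id.const_mul_atTop hq)
  have hlim : Filter.Tendsto u Filter.atTop (nhds 0) := by
    have h0 : Filter.Tendsto (fun r => Real.exp (-(q * r)) * (D + D)) Filter.atTop (nhds 0) := by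
      simpa using hexp.mul_const (D + D)
    refine squeeze_zero_norm' ?_ h0
    filter_upwards [Filter.eventually_ge_atTop 0] with r hr
    rw [norm_mul, Real.norm_eq_abs, Real.abs_exp, Real.norm_eq_abs]
    gcongr
    exact (abs_add_le _ _).trans (add_le_add (hkD r hr) (hzD r hr))
  have hint : IntegrableOn
      (fun r => -(q * Real.exp (-(q * r)) * ((∫ ρ in (0)..r, z ρ) + p r))) (Set.Ioi 0) := by
    have h0 : IntegrableOn (fun r => q * (D + D) * Real.exp (-q * r)) (Set.Ioi 0) :=
      (exp_neg_integrableOn_Ioi 0 hq).const_mul _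
    refine h0.mono' ?_ ?_
    · exact Continuous.aestronglyMeasurable (by fun_prop)
    · filter_upwards [ae_restrict_mem measurableSet_Ioi] with r hr
      have hr : 0 ≤ r := le_of_lt hr
      rw [norm_neg, norm_mul, norm_mul, Real.norm_eq_abs, Real.norm_eq_abs, Real.norm_eq_abs,
        Real.abs_exp, abs_of_pos hq, neg_mul]
      have h1 := (abs_add_le _ _).trans (add_le_add (hzD r hr) (hpD r hr))
      have h2 := mul_le_mul_of_nonneg_left h1
        (by positivity : 0 ≤ q * Real.exp (-(q * r)))
      linarith
  have hfund := integral_Ioi_of_hasDerivAt_of_tendsto (hu 0).continuousAt.continuousWithinAt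
    (fun r _ => hu r) hint hlim
  rw [integral_neg] at hfund
  rw [integral_expMeasure hq]
  simp [u] at hfund
  linarith

variable {d : ℕ} {Λ : Finset (Site d)}

instance instMeasurableSpaceOptionSubtype : MeasurableSpace (Option Λ) := ⊤

instance instDiscreteOptionSubtype : DiscreteMeasurableSpace (Option Λ) := ⟨fun _ => trivial⟩

/-- The state of the killed jump chain: accumulated local times and current position. -/
abbrev ChainState (Λ : Finset (Site d)) : Type := (Λ → ℝ) × Option Λ

/-- The position after a jump by `ξ` from `x`, which is `none` outside `Λ`. -/
def jumpTo (x : Λ) (ξ : Site d) : Option Λ :=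
  if h : (x : Site d) + ξ ∈ Λ then some ⟨x + ξ, h⟩ else none

theorem jumpTo_eq_some_iff (x y : Λ) (ξ : Site d) :
    jumpTo x ξ = some y ↔ ξ = (y : Site d) - x := by
  unfold jumpTo
  rw [eq_sub_iff_add_eq']
  split_ifs with h
  · rw [Option.some_inj, Subtype.ext_iff]
  · simp only [false_iff]
    intro e
    exact h (e ▸ y.2)

/-- The chain sits at its position for a time `w.2`, then jumps by `w.1`. -/
def chainStep (S : ChainState Λ) (w : Site d × ℝ) : ChainState Λ :=
  S.2.elim (S.1, none) fun x => (S.1 + Pi.single x w.2, jumpTo x w.1)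

/-- The extension by zero to the cemetery state. -/
def killedExt (K : (Λ → ℝ) → Λ → ℝ) (S : ChainState Λ) : ℝ := S.2.elim 0 fun x => K S.1 x

/-- The weight `∫₀ʳ Z (s + ρ e_b) dρ` collected while sitting at `b` for a time `r`. -/
noncomputable def sojourn (Z : (Λ → ℝ) → ℝ) (b : Λ) (S : ChainState Λ) (r : ℝ) : ℝ :=
  if S.2 = some b then ∫ ρ in (0)..r, Z (S.1 + Pi.single b ρ) else 0

theorem stepLaw_real_singleton {J : Site d → ℝ} (hd : 1 ≤ d) (hJ : IsJumpRate J) (z : Site d) :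
    (stepLaw J).real {z} = if z = 0 then 0 else J z / totalRate J := by
  have hpos := hJ.totalRate_pos hd
  rw [Measure.real, stepLaw, Measure.sum_apply _ (measurableSet_singleton z)]
  simp only [Measure.smul_apply, smul_eq_mul, Measure.dirac_apply' _ (measurableSet_singleton z)]
  split_ifs with h
  · subst h
    have : ∀ y : {y : Site d // y ≠ 0}, Set.indicator {(0 : Site d)} (1 : Site d → ℝ≥0∞) y = 0 :=
      fun y => Set.indicator_of_notMem (by simpa using y.2) _
    simp [this]
  · rw [tsum_eq_single ⟨z, h⟩]
    · simp [ENNReal.toReal_ofReal (div_nonneg (hJ.nonneg z h) hpos.le)]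
    · intro y hy
      rw [Set.indicator_of_notMem, mul_zero]
      intro e
      exact hy (Subtype.ext e)

/-- Analytic data of the renewal argument: `K` solves the evolution equation with source `Z`,
and both decay exponentially in the total local time. -/
structure IsRenewalPair (J : Site d → ℝ) (b : Λ) (K : (Λ → ℝ) → Λ → ℝ) (Z : (Λ → ℝ) → ℝ) :
    Prop where
  continuous_left : ∀ x, Continuous fun s => K s x
  continuous_right : Continuous Z
  pos : ∀ s, 0 < Z s
  bound : ∃ D : ℝ, 0 ≤ D ∧ (∀ s x, |K s x| ≤ D * Real.exp (-8 * ∑ x, s x)) ∧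
    ∀ s, Z s ≤ D * Real.exp (-8 * ∑ x, s x)
  hasDerivAt : ∀ (s : Λ → ℝ) (x : Λ) (r : ℝ), HasDerivAt (fun r => K (s + Pi.single x r) x)
    (-(∑ y, laplacian J Λ x y * K (s + Pi.single x r) y) -
      if x = b then Z (s + Pi.single x r) else 0) r

theorem isRenewalPair {J : Site d → ℝ} (hd : 1 ≤ d) (hJ : IsJumpRate J) {n : ℕ} (hn : 1 ≤ n)
    {g : ℝ} (hg : 0 < g) (ν : ℝ) (b : Λ) :
    IsRenewalPair J b (twoPoint J n g ν b) (partitionFn J n g ν) where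
  continuous_left x := continuous_twoPoint hd hJ hg ν x b
  continuous_right := continuous_partitionFn hd hJ hg ν
  pos := partitionFn_pos hd hJ hg ν
  bound := by
    obtain ⟨D, hD, h⟩ := exists_abs_twoPoint_le (n := n) hd hJ hg ν b
    obtain ⟨D', hD', h'⟩ := exists_partitionFn_le (n := n) (Λ := Λ) hd hJ hg ν
    refine ⟨D + D', by positivity, fun s x => (h s x).trans ?_, fun s => (h' s).trans ?_⟩
    · gcongr; linarith
    · gcongr; linarith
  hasDerivAt s x r := hasDerivAt_twoPoint hd hJ hn hg ν s x b r

variable {J : Site d → ℝ} {b : Λ} {K : (Λ → ℝ) → Λ → ℝ} {Z : (Λ → ℝ) → ℝ}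

theorem sum_add_single (s : Λ → ℝ) (x : Λ) (r : ℝ) :
    ∑ y, (s + Pi.single x r : Λ → ℝ) y = ∑ y, s y + r := by
  simp [Finset.sum_add_distrib]

theorem continuous_add_single (s : Λ → ℝ) (x : Λ) :
    Continuous fun r : ℝ => (s + Pi.single x r : Λ → ℝ) :=
  continuous_const.add (continuous_single (A := fun _ : Λ => ℝ) x)

/-- The field grows at unit speed at `x`, so the integrand decays like `exp (-8 ρ)`. Its integral is
at most 1/8, so the bound for `Z` also serves for the weight collected in a sojourn. -/
theorem integral_le_of_le_exp {D : ℝ} (hD : 0 ≤ D) (hZ : Continuous Z) (hpos : ∀ s, 0 < Z s)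
    (h : ∀ s, Z s ≤ D * Real.exp (-8 * ∑ x, s x)) (s : Λ → ℝ) (x : Λ) {r : ℝ} (hr : 0 ≤ r) :
    |∫ ρ in (0)..r, Z (s + Pi.single x ρ)| ≤ D * Real.exp (-8 * ∑ x, s x) := by
  have hc : Continuous fun ρ => Z (s + Pi.single x ρ) := hZ.comp (continuous_add_single s x)
  rw [abs_of_nonneg (intervalIntegral.integral_nonneg hr fun ρ _ => (hpos _).le)]
  have hb : Continuous fun ρ : ℝ => D * Real.exp (-8 * ∑ x, s x) * Real.exp (-8 * ρ) := by
    fun_prop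
  have hderiv : ∀ ρ : ℝ, HasDerivAt (fun ρ => -(Real.exp (-8 * ρ) / 8)) (Real.exp (-8 * ρ)) ρ := by
    intro ρ
    refine ((((hasDerivAt_id ρ).const_mul (-8)).exp).div_const 8).fun_neg.congr_deriv ?_
    simp only [id]
    ring
  calc ∫ ρ in (0)..r, Z (s + Pi.single x ρ)
      ≤ ∫ ρ in (0)..r, D * Real.exp (-8 * ∑ x, s x) * Real.exp (-8 * ρ) := by
        refine intervalIntegral.integral_mono_on hr (hc.intervalIntegrable _ _)
          (hb.intervalIntegrable _ _) fun ρ _ => (h _).trans_eq ?_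
        rw [sum_add_single, mul_assoc, ← Real.exp_add]
        congr 2
        ring
    _ = D * Real.exp (-8 * ∑ x, s x) * ((1 - Real.exp (-8 * r)) / 8) := by
        rw [intervalIntegral.integral_const_mul,
          intervalIntegral.integral_eq_sub_of_hasDerivAt (fun ρ _ => hderiv ρ)
            (Continuous.intervalIntegrable (by fun_prop) _ _)]
        simp
        ring_nf
        simp
    _ ≤ D * Real.exp (-8 * ∑ x, s x) * 1 := by
        refine mul_le_mul_of_nonneg_left ?_ (by positivity)
        have := Real.exp_pos (-8 * r)
        linarith
    _ = _ := mul_one _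

theorem integrable_expMeasure_of_bound {q D : ℝ} (hq : 0 < q) {f : ℝ → ℝ} (hf : Measurable f)
    (hD : ∀ r, 0 ≤ r → |f r| ≤ D) : Integrable f (expMeasure q) := by
  have := isProbabilityMeasure_expMeasure hq
  refine Integrable.of_bound hf.aestronglyMeasurable D ?_
  filter_upwards [ae_pos_expMeasure q] with r hr
  exact hD r hr.le

/-- While the chain sits at `x`, the map `r ↦ K (s + r e_x) x` solves a scalar linear ODE with rate
`q`, whose source terms are the mean of `K` after a jump and `Z` if `x = b`. Variation of constants
writes its initial value as an average over an exponential time; independence of jump and holding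
time makes this the integral over the product law. In the cemetery both sides are zero. -/
theorem IsRenewalPair.one_step (hd : 1 ≤ d) (hJ : IsJumpRate J) (h : IsRenewalPair J b K Z)
    (S : ChainState Λ) :
    killedExt K S = ∫ w, (sojourn Z b S w.2 + killedExt K (chainStep S w))
      ∂(stepLaw J).prod (expMeasure (totalRate J)) := by
  have hq := hJ.totalRate_pos hd
  have := isProbabilityMeasure_stepLaw hd hJ
  have := isProbabilityMeasure_expMeasure hq
  obtain ⟨s, _ | x⟩ := S
  · simp [killedExt, chainStep, sojourn]
  obtain ⟨D, hD, hK, hZ⟩ := h.bound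
  set q := totalRate J
  have hKr : ∀ y r, 0 ≤ r → |K (s + Pi.single x r) y| ≤ D * Real.exp (-8 * ∑ x, s x) := by
    intro y r hr
    refine (hK _ _).trans ?_
    rw [sum_add_single]
    gcongr D * Real.exp ?_
    linarith
  have hKc : ∀ y, Continuous fun r => K (s + Pi.single x r) y := fun y =>
    (h.continuous_left y).comp (continuous_add_single s x)
  have hKi : ∀ y, Integrable (fun r => K (s + Pi.single x r) y) (expMeasure q) := fun y =>
    integrable_expMeasure_of_bound hq (hKc y).measurable (hKr y)
  let z : ℝ → ℝ := fun r => if x = b then Z (s + Pi.single x r) else 0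
  have hzc : Continuous z := by
    simp only [z]
    split_ifs
    · exact h.continuous_right.comp (continuous_add_single s x)
    · exact continuous_const
  have hzi : ∀ r, sojourn Z b (s, some x) r = ∫ ρ in (0)..r, z ρ := fun r => by
    simp only [sojourn, z, Option.some_inj]
    split_ifs with e
    · rw [e]
    · simp
  have hzD : ∀ r, 0 ≤ r → |∫ ρ in (0)..r, z ρ| ≤ D * Real.exp (-8 * ∑ x, s x) := fun r hr => by
    simp only [z]
    split_ifs
    · exact integral_le_of_le_exp hD h.continuous_right h.pos hZ s x hr
    · simp
      positivity
  have hzm : Continuous fun r => ∫ ρ in (0)..r, z ρ :=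
    intervalIntegral.continuous_primitive (fun _ _ => hzc.intervalIntegrable _ _) 0
  let c : Λ → ℝ := fun y => (stepLaw J).real {(y : Site d) - x}
  have hc : ∀ y, c y = if x = y then 0 else J ((y : Site d) - x) / q := fun y => by
    simp only [c, stepLaw_real_singleton hd hJ, sub_eq_zero, Subtype.ext_iff]
    simp only [eq_comm]
    rfl
  -- The mean of `K` just after a jump from `x`, landings outside `Λ` counting zero.
  let p : ℝ → ℝ := fun r => ∑ y, c y * K (s + Pi.single x r) y
  have hpc : Continuous p := continuous_finsetSum _ fun y _ => continuous_const.mul (hKc y)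
  -- Splitting by landing site writes the integrand as a finite sum of products of a function of the
  -- jump and one of the holding time.
  have hexpand : ∀ w : Site d × ℝ, killedExt K (chainStep (s, some x) w) =
      ∑ y : Λ, Set.indicator {(y : Site d) - x} (1 : Site d → ℝ) w.1 *
        K (s + Pi.single x w.2) y := by
    intro w
    have hind : ∀ y : Λ, Set.indicator {(y : Site d) - x} (1 : Site d → ℝ) w.1 =
        if jumpTo x w.1 = some y then 1 else 0 := fun y => by
      simp only [Set.indicator, Set.mem_singleton_iff, jumpTo_eq_some_iff, Pi.one_apply]
    simp only [hind, chainStep, killedExt, Option.elim_some]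
    cases jumpTo x w.1 <;> simp
  have hint1 : Integrable (fun w : Site d × ℝ => sojourn Z b (s, some x) w.2)
      ((stepLaw J).prod (expMeasure q)) := by
    simp only [hzi]
    exact (integrable_expMeasure_of_bound hq hzm.measurable hzD).comp_snd _
  have hint2 : ∀ y : Λ, Integrable (fun w : Site d × ℝ =>
      Set.indicator {(y : Site d) - x} (1 : Site d → ℝ) w.1 * K (s + Pi.single x w.2) y)
      ((stepLaw J).prod (expMeasure q)) := fun y => by
    refine Integrable.mul_prod ?_ (hKi y)
    exact (integrable_const (1 : ℝ)).indicator (measurableSet_singleton _)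
  have hpD : ∀ r, 0 ≤ r → |p r| ≤ ∑ y, |c y| * (D * Real.exp (-8 * ∑ x, s x)) := fun r hr => by
    refine (Finset.abs_sum_le_sum_abs _ _).trans (Finset.sum_le_sum fun y _ => ?_)
    rw [abs_mul]
    exact mul_le_mul_of_nonneg_left (hKr y r hr) (abs_nonneg _)
  have hB : 0 ≤ ∑ y, |c y| * (D * Real.exp (-8 * ∑ x, s x)) := by positivity
  have hB' : 0 ≤ D * Real.exp (-8 * ∑ x, s x) := by positivity
  -- The diagonal entry `-q` of the Laplacian yields the term `q K`, and the off-diagonal entries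
  -- are `q` times the jump probabilities.
  have hode : ∀ r, HasDerivAt (fun r => K (s + Pi.single x r) x)
      (q * (K (s + Pi.single x r) x - p r) - z r) r := fun r => by
    refine (h.hasDerivAt s x r).congr_deriv ?_
    have e1 : ∀ y, laplacian J Λ x y * K (s + Pi.single x r) y =
        q * (c y * K (s + Pi.single x r) y) -
          if x = y then q * K (s + Pi.single x r) y else 0 := fun y => by
      rw [hc]
      split_ifs with e
      · subst e
        simp [laplacian, q, totalRate]
      · rw [laplacian]
        field_simp
        ring
    simp only [e1, Finset.sum_sub_distrib, Finset.sum_ite_eq, Finset.mem_univ, if_true,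
      ← Finset.mul_sum]
    simp only [p, z]
    ring
  have hvar := eq_integral_expMeasure_of_hasDerivAt hq
    (D := D * Real.exp (-8 * ∑ x, s x) + ∑ y, |c y| * (D * Real.exp (-8 * ∑ x, s x)))
    hode hzc hpc (fun r hr => (hKr x r hr).trans (by linarith))
    (fun r hr => (hpD r hr).trans (by linarith)) (fun r hr => (hzD r hr).trans (by linarith))
  simp only [hexpand]
  rw [integral_add hint1 (integrable_finsetSum _ fun y _ => hint2 y),
    integral_finsetSum _ fun y _ => hint2 y]
  rw [integral_add (integrable_expMeasure_of_bound hq hzm.measurable hzD)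
    (integrable_expMeasure_of_bound hq hpc.measurable hpD)] at hvar
  simp only [Pi.single_zero, add_zero] at hvar
  change K s x = _
  rw [hvar]
  congr 1
  · simp only [hzi]
    rw [integral_fun_snd (fun r => ∫ ρ in (0)..r, z ρ)]
    simp
  · simp only [p]
    rw [integral_finsetSum _ fun y _ => (hKi y).const_mul _]
    refine Finset.sum_congr rfl fun y _ => ?_
    have hmul := integral_prod_mul (μ := stepLaw J) (ν := expMeasure q)
      (Set.indicator {(y : Site d) - x} (1 : Site d → ℝ)) (fun r : ℝ => K (s + Pi.single x r) y)
    rw [hmul, integral_indicator_one (measurableSet_singleton _), integral_const_mul]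

end OneStep

/-! ### Path properties of the killed walk -/

section Paths

variable {d : ℕ} {Λ : Finset (Site d)}

/-- The killed jump chain driven by the pairs (displacement, holding time) `w`. -/
def chainPath (t : Λ → ℝ) (a : Λ) (w : ℕ → Site d × ℝ) : ℕ → ChainState Λ
  | 0 => (t, some a)
  | m + 1 => chainStep (chainPath t a w m) (w m)

/-- The successive jump times. -/
def jumpTime (w : ℕ → Site d × ℝ) (m : ℕ) : ℝ := ∑ k ∈ Finset.range m, (w k).2

/-- The successive positions of the unkilled walk. -/
def jumpPos (a : Site d) (w : ℕ → Site d × ℝ) (m : ℕ) : Site d :=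
  a + ∑ k ∈ Finset.range m, (w k).1

theorem jumpTime_succ (w : ℕ → Site d × ℝ) (m : ℕ) :
    jumpTime w (m + 1) = jumpTime w m + (w m).2 := Finset.sum_range_succ _ _

theorem jumpPos_succ (a : Site d) (w : ℕ → Site d × ℝ) (m : ℕ) :
    jumpPos a w (m + 1) = jumpPos a w m + (w m).1 := by
  rw [jumpPos, jumpPos, Finset.sum_range_succ, add_assoc]

theorem jumpTime_nonneg {w : ℕ → Site d × ℝ} (hw : ∀ k, 0 < (w k).2) (m : ℕ) :
    0 ≤ jumpTime w m := Finset.sum_nonneg fun k _ => (hw k).le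

theorem jumpTime_strictMono {w : ℕ → Site d × ℝ} (hw : ∀ k, 0 < (w k).2) :
    StrictMono (jumpTime w) := strictMono_nat_of_lt_succ fun m => by
  rw [jumpTime_succ]
  linarith [hw m]

theorem exists_jumpTime_le (w : ℕ → Site d × ℝ) {ℓ : ℝ} (hℓ : 0 ≤ ℓ) (m : ℕ)
    (hm : ℓ < jumpTime w m) : ∃ k < m, jumpTime w k ≤ ℓ ∧ ℓ < jumpTime w (k + 1) := by
  induction m with
  | zero =>
    simp [jumpTime] at hm
    linarith
  | succ m ih =>
    by_cases h : ℓ < jumpTime w m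
    · obtain ⟨k, hk, h'⟩ := ih h
      exact ⟨k, hk.trans m.lt_succ_self, h'⟩
    · exact ⟨m, m.lt_succ_self, not_lt.mp h, hm⟩

theorem chainPath_succ_snd_eq_some {t : Λ → ℝ} {a : Λ} {w : ℕ → Site d × ℝ} {m : ℕ} {z : Λ}
    (h : (chainPath t a w (m + 1)).2 = some z) :
    ∃ y, (chainPath t a w m).2 = some y ∧ (w m).1 = (z : Site d) - y ∧
      (chainPath t a w (m + 1)).1 = (chainPath t a w m).1 + Pi.single y (w m).2 := by
  change (chainStep (chainPath t a w m) (w m)).2 = some z at h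
  change ∃ y, _ ∧ _ ∧ (chainStep (chainPath t a w m) (w m)).1 = _
  unfold chainStep at h ⊢
  cases e : (chainPath t a w m).2 with
  | none => simp [e] at h
  | some y =>
    rw [e] at h
    exact ⟨y, rfl, (jumpTo_eq_some_iff y z _).mp h, rfl⟩

/-- The whole history is needed: the unkilled walk may leave `Λ` and come back, whereas the chain
stays in the cemetery. -/
theorem chainPath_snd_eq_some_iff (t : Λ → ℝ) (a : Λ) (w : ℕ → Site d × ℝ) (m : ℕ) (z : Λ) :
    (chainPath t a w m).2 = some z ↔
      (∀ k ≤ m, jumpPos a w k ∈ Λ) ∧ jumpPos a w m = z := by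
  induction m generalizing z with
  | zero =>
    constructor
    · intro h
      obtain rfl : a = z := Option.some_inj.mp h
      refine ⟨fun k hk => ?_, by simp [jumpPos]⟩
      obtain rfl := Nat.le_zero.mp hk
      simp [jumpPos]
    · rintro ⟨-, h⟩
      obtain rfl : a = z := Subtype.ext (by simpa [jumpPos] using h)
      rfl
  | succ m ih =>
    constructor
    · intro h
      obtain ⟨y, hy, hw, -⟩ := chainPath_succ_snd_eq_some h
      obtain ⟨h1, h2⟩ := (ih y).mp hy
      have h3 : jumpPos a w (m + 1) = z := by
        rw [jumpPos_succ, h2, hw]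
        abel
      refine ⟨fun k hk => ?_, h3⟩
      rcases Nat.le_succ_iff.mp hk with hk | rfl
      · exact h1 k hk
      · rw [h3]
        exact z.2
    · rintro ⟨h1, h2⟩
      have hy := (ih ⟨jumpPos a w m, h1 m m.le_succ⟩).mpr
        ⟨fun k hk => h1 k (hk.trans m.le_succ), rfl⟩
      change (chainStep (chainPath t a w m) (w m)).2 = some z
      unfold chainStep
      rw [hy]
      refine (jumpTo_eq_some_iff _ z _).mpr ?_
      rw [← h2, jumpPos_succ]
      simp

variable {Ω : Type*} {X : ℝ → Ω → Site d} {ω : Ω} {t : Λ → ℝ} {a : Λ} {w : ℕ → Site d × ℝ}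

/-- The path `X · ω` jumps according to the driving sequence `w`. -/
def FollowsJumps (X : ℝ → Ω → Site d) (ω : Ω) (a : Site d) (w : ℕ → Site d × ℝ) : Prop :=
  ∀ (ℓ : ℝ) (m : ℕ), 0 ≤ ℓ → jumpTime w m ≤ ℓ → ℓ < jumpTime w (m + 1) → X ℓ ω = jumpPos a w m

theorem FollowsJumps.killedWalk_eq_some (hX : FollowsJumps X ω a w) (hw : ∀ k, 0 < (w k).2)
    {m : ℕ} {z : Λ} (hz : (chainPath t a w m).2 = some z) {ℓ : ℝ} (h1 : jumpTime w m ≤ ℓ)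
    (h2 : ℓ < jumpTime w (m + 1)) : killedWalk Λ X ℓ ω = some (z : Site d) := by
  obtain ⟨hin, hzm⟩ := (chainPath_snd_eq_some_iff t a w m z).mp hz
  -- A time before the next jump lies in one of the holding intervals up to `m`, all spent in `Λ`;
  -- so the exit time is at least the next jump time.
  have hexit : (ℓ : EReal) < exitTime Λ X ω := by
    refine lt_of_lt_of_le (EReal.coe_lt_coe_iff.mpr h2) (le_iInf₂ fun r hr => ?_)
    rw [EReal.coe_le_coe_iff]
    by_contra hlt
    obtain ⟨k, hk, h3, h4⟩ := exists_jumpTime_le w hr.1 (m + 1) (not_le.mp hlt)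
    refine hr.2 ?_
    rw [hX r k hr.1 h3 h4]
    exact hin k (Nat.le_of_lt_succ hk)
  rw [killedWalk, if_pos hexit, hX ℓ m ((jumpTime_nonneg hw m).trans h1) h1 h2, hzm]

theorem FollowsJumps.killedWalk_eq_none (hX : FollowsJumps X ω a w) (hw : ∀ k, 0 < (w k).2)
    {m : ℕ} (hz : (chainPath t a w m).2 = none) {ℓ : ℝ} (h1 : jumpTime w m ≤ ℓ) :
    killedWalk Λ X ℓ ω = none := by
  have hout : ∃ k ≤ m, jumpPos (a : Site d) w k ∉ Λ := by
    by_contra! hcon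
    have := (chainPath_snd_eq_some_iff t a w m ⟨_, hcon m le_rfl⟩).mpr ⟨hcon, rfl⟩
    rw [hz] at this
    cases this
  obtain ⟨k, hk, hkout⟩ := hout
  have hmono := jumpTime_strictMono hw
  -- Holding intervals contain their left endpoints, so the walk is already outside `Λ` at the jump
  -- time itself.
  have hexit : exitTime Λ X ω ≤ (ℓ : EReal) := by
    refine (iInf₂_le (jumpTime w k) ⟨jumpTime_nonneg hw k, ?_⟩).trans
      (EReal.coe_le_coe_iff.mpr ((hmono.monotone hk).trans h1))
    rwa [hX _ k (jumpTime_nonneg hw k) le_rfl (hmono k.lt_succ_self)]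
  rw [killedWalk, if_neg (not_lt.mpr hexit)]

open Classical in
theorem FollowsJumps.integral_holding (hX : FollowsJumps X ω a w) (hw : ∀ k, 0 < (w k).2)
    {m : ℕ} {z : Λ} (hz : (chainPath t a w m).2 = some z) {ℓ : ℝ} (h1 : jumpTime w m ≤ ℓ)
    (h2 : ℓ ≤ jumpTime w (m + 1)) (x : Λ) :
    IntervalIntegrable (fun s => if killedWalk Λ X s ω = some (x : Site d) then (1 : ℝ) else 0)
        volume (jumpTime w m) ℓ ∧
      ∫ s in (jumpTime w m)..ℓ, (if killedWalk Λ X s ω = some (x : Site d) then (1 : ℝ) else 0) =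
        (Pi.single z (ℓ - jumpTime w m) : Λ → ℝ) x := by
  have hae : ∀ᵐ s : ℝ, s ∈ Set.uIoc (jumpTime w m) ℓ →
      (if x = z then (1 : ℝ) else 0) =
        if killedWalk Λ X s ω = some (x : Site d) then (1 : ℝ) else 0 := by
    -- The endpoint `ℓ` may be the next jump time, where the walk has already moved; it is a null
    -- set.
    have hne : ∀ᵐ s : ℝ, s ≠ ℓ := by
      rw [ae_iff]
      simp
    filter_upwards [hne] with s hs hmem
    rw [Set.uIoc_of_le h1] at hmem
    rw [hX.killedWalk_eq_some hw hz hmem.1.le ((lt_of_le_of_ne hmem.2 hs).trans_le h2)]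
    simp only [Option.some_inj, Subtype.ext_iff, eq_comm]
  constructor
  · refine (intervalIntegrable_const (c := if x = z then (1 : ℝ) else 0)).congr_ae ?_
    rw [Filter.EventuallyEq, ae_restrict_iff' measurableSet_uIoc]
    exact hae
  · rw [← intervalIntegral.integral_congr_ae hae, intervalIntegral.integral_const, smul_eq_mul]
    by_cases e : x = z
    · subst e
      simp
    · simp [e]

open Classical in
theorem FollowsJumps.integral_jumpTime (hX : FollowsJumps X ω a w) (hw : ∀ k, 0 < (w k).2)
    (m : ℕ) {z : Λ} (hz : (chainPath t a w m).2 = some z) (x : Λ) :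
    IntervalIntegrable (fun s => if killedWalk Λ X s ω = some (x : Site d) then (1 : ℝ) else 0)
        volume 0 (jumpTime w m) ∧
      t x + ∫ s in (0)..(jumpTime w m),
        (if killedWalk Λ X s ω = some (x : Site d) then (1 : ℝ) else 0) =
        (chainPath t a w m).1 x := by
  induction m generalizing z with
  | zero => simp [jumpTime, chainPath]
  | succ m ih =>
    obtain ⟨y, hy, -, hs⟩ := chainPath_succ_snd_eq_some hz
    obtain ⟨i1, e1⟩ := ih hy
    obtain ⟨i2, e2⟩ := hX.integral_holding hw hy
      ((jumpTime_strictMono hw).monotone m.le_succ) le_rfl x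
    refine ⟨i1.trans i2, ?_⟩
    rw [← intervalIntegral.integral_add_adjacent_intervals i1 i2, ← add_assoc, e1, e2, hs,
      jumpTime_succ]
    simp

theorem FollowsJumps.add_localTime (hX : FollowsJumps X ω a w) (hw : ∀ k, 0 < (w k).2)
    {m : ℕ} {z : Λ} (hz : (chainPath t a w m).2 = some z) {ℓ : ℝ} (h1 : jumpTime w m ≤ ℓ)
    (h2 : ℓ < jumpTime w (m + 1)) :
    t + localTime Λ X (Set.Icc 0 ℓ) ω =
      (chainPath t a w m).1 + Pi.single z (ℓ - jumpTime w m) := by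
  funext x
  obtain ⟨i1, e1⟩ := hX.integral_jumpTime hw m hz x
  obtain ⟨i2, e2⟩ := hX.integral_holding hw hz h1 h2.le x
  rw [Pi.add_apply, Pi.add_apply, localTime, integral_Icc_eq_integral_Ioc,
    ← intervalIntegral.integral_of_le ((jumpTime_nonneg hw m).trans h1),
    ← intervalIntegral.integral_add_adjacent_intervals i1 i2, ← add_assoc, e1, e2]

open Classical in
/-- The contribution to the Green's function integrand of the `m`-th holding interval. -/
noncomputable def holdingTerm (F : (Λ → ℝ) → ℝ) (b : Λ) (S : ChainState Λ) (T σ ℓ : ℝ) : ℝ≥0∞ :=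
  if (T ≤ ℓ ∧ ℓ < T + σ) ∧ S.2 = some b then
    ENNReal.ofReal (F (S.1 + Pi.single b (ℓ - T))) else 0

open Classical in
-- Since the jump times increase to infinity, `ℓ` lies in exactly one holding interval, and only
-- that summand can be non-zero.
theorem FollowsJumps.integrand_eq_tsum (hX : FollowsJumps X ω a w) (hw : ∀ k, 0 < (w k).2)
    (hT : Filter.Tendsto (jumpTime w) Filter.atTop Filter.atTop) (F : (Λ → ℝ) → ℝ) (b : Λ)
    {ℓ : ℝ} (hℓ : 0 ≤ ℓ) :
    (if killedWalk Λ X ℓ ω = some (b : Site d) then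
      ENNReal.ofReal (F (t + localTime Λ X (Set.Icc 0 ℓ) ω)) else 0) =
      ∑' m, holdingTerm F b (chainPath t a w m) (jumpTime w m) (w m).2 ℓ := by
  obtain ⟨M, hM⟩ := (hT.eventually (Filter.eventually_gt_atTop ℓ)).exists
  obtain ⟨m, -, h1, h2⟩ := exists_jumpTime_le w hℓ M hM
  have hmono := jumpTime_strictMono hw
  rw [tsum_eq_single m]
  · rw [holdingTerm]
    rw [jumpTime_succ] at h2
    simp only [h1, h2, true_and]
    rw [← jumpTime_succ] at h2
    cases e : (chainPath t a w m).2 with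
    | none => rw [hX.killedWalk_eq_none hw e h1]; simp
    | some z =>
      rw [hX.killedWalk_eq_some hw e h1 h2, hX.add_localTime hw e h1 h2]
      simp only [Option.some_inj, Subtype.val_inj]
      split_ifs with hzb
      · rw [hzb]
      · rfl
  · intro k hk
    rw [holdingTerm, if_neg]
    rintro ⟨⟨h3, h4⟩, -⟩
    rw [← jumpTime_succ] at h4
    rcases lt_or_gt_of_ne hk with hlt | hgt
    · exact absurd (h4.trans_le ((hmono.monotone (Nat.succ_le_of_lt hlt)).trans h1)) (lt_irrefl _)
    · exact absurd (h2.trans_le ((hmono.monotone (Nat.succ_le_of_lt hgt)).trans h3)) (lt_irrefl _)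

theorem lintegral_holdingTerm {Z : (Λ → ℝ) → ℝ} (hZ : Continuous Z) (hpos : ∀ s, 0 < Z s) {c : ℝ}
    (hc : 0 < c) (b : Λ) (S : ChainState Λ) {T σ : ℝ} (hT : 0 ≤ T) (hσ : 0 < σ) :
    ∫⁻ ℓ in Set.Ici (0 : ℝ), holdingTerm (fun s => Z s / c) b S T σ ℓ =
      ENNReal.ofReal (sojourn Z b S σ / c) := by
  unfold holdingTerm sojourn
  by_cases hb : S.2 = some b
  · simp only [hb, and_true, if_true]
    have hcont : Continuous fun ℓ : ℝ => Z (S.1 + Pi.single b (ℓ - T)) / c :=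
      (hZ.comp ((continuous_add_single S.1 b).comp
        (continuous_id.sub continuous_const))).div_const c
    have e1 : ∀ ℓ : ℝ, (if T ≤ ℓ ∧ ℓ < T + σ then
        ENNReal.ofReal (Z (S.1 + Pi.single b (ℓ - T)) / c) else 0) =
        (Set.Ico T (T + σ)).indicator
          (fun ℓ => ENNReal.ofReal (Z (S.1 + Pi.single b (ℓ - T)) / c)) ℓ := fun ℓ => by
      simp only [Set.indicator_apply, Set.mem_Ico]
    simp only [e1]
    rw [lintegral_indicator measurableSet_Ico, Measure.restrict_restrict measurableSet_Ico,
      Set.inter_eq_left.mpr (Set.Ico_subset_Ici_self.trans (Set.Ici_subset_Ici.mpr hT)),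
      setLIntegral_congr Ico_ae_eq_Ioc,
      ← ofReal_integral_eq_lintegral_ofReal]
    · have hshift := intervalIntegral.integral_comp_sub_right (a := T) (b := T + σ)
        (fun ρ : ℝ => Z (S.1 + Pi.single b ρ)) T
      rw [sub_self, add_sub_cancel_left] at hshift
      rw [← intervalIntegral.integral_of_le (by linarith), intervalIntegral.integral_div, hshift]
    · exact (hcont.integrableOn_Icc (a := T) (b := T + σ)).mono_set Set.Ioc_subset_Icc_self
    · exact Filter.Eventually.of_forall fun ℓ => (div_pos (hpos _) hc).le
  · simp [hb]

end Paths

/-! ### The renewal argument -/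

section Renewal

variable {d : ℕ} {Λ : Finset (Site d)}

theorem continuous_add_single_prod (x : Λ) :
    Continuous fun p : (Λ → ℝ) × ℝ => (p.1 + Pi.single x p.2 : Λ → ℝ) :=
  continuous_fst.add ((continuous_single (A := fun _ : Λ => ℝ) x).comp continuous_snd)

theorem measurable_chainStep :
    Measurable fun p : ChainState Λ × (Site d × ℝ) => chainStep p.1 p.2 := by
  have h : Measurable fun p : ((Λ → ℝ) × (Site d × ℝ)) × Option Λ =>
      chainStep (p.1.1, p.2) p.1.2 := by
    refine measurable_from_prod_countable_left fun o => ?_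
    cases o with
    | none => exact measurable_fst.prodMk measurable_const
    | some x =>
      refine Measurable.prodMk ?_ ?_
      · exact (continuous_add_single_prod x).measurable.comp
          (measurable_fst.prodMk measurable_snd.snd)
      · exact (measurable_of_countable (jumpTo x)).comp measurable_snd.fst
  exact h.comp ((measurable_fst.fst.prodMk measurable_snd).prodMk measurable_fst.snd)

theorem measurable_killedExt {K : (Λ → ℝ) → Λ → ℝ} (hK : ∀ x, Continuous fun s => K s x) :
    Measurable (killedExt K) := by
  refine measurable_from_prod_countable_left fun o => ?_
  cases o with
  | none => exact measurable_const
  | some x => exact (hK x).measurable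

theorem measurable_sojourn {Z : (Λ → ℝ) → ℝ} (hZ : Continuous Z) (b : Λ) :
    Measurable fun p : ChainState Λ × ℝ => sojourn Z b p.1 p.2 := by
  have hc : Continuous fun p : (Λ → ℝ) × ℝ => ∫ ρ in (0)..p.2, Z (p.1 + Pi.single b ρ) := by
    refine intervalIntegral.continuous_parametric_intervalIntegral_of_continuous ?_ continuous_snd
    exact hZ.comp ((continuous_add_single_prod b).comp
      ((continuous_fst.comp continuous_fst).prodMk continuous_snd))
  refine Measurable.ite ?_ (hc.measurable.comp (measurable_fst.fst.prodMk measurable_snd))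
    measurable_const
  exact measurable_fst.snd (MeasurableSet.of_discrete (s := {some b}))

theorem measurable_chainPath (t : Λ → ℝ) (a : Λ) (m : ℕ) :
    Measurable fun w : ℕ → Site d × ℝ => chainPath t a w m := by
  induction m with
  | zero => exact measurable_const
  | succ m ih => exact measurable_chainStep.comp (ih.prodMk (measurable_pi_apply m))

theorem chainPath_congr (t : Λ → ℝ) (a : Λ) {w w' : ℕ → Site d × ℝ} (m : ℕ)
    (h : ∀ k < m, w k = w' k) : chainPath t a w m = chainPath t a w' m := by
  induction m with
  | zero => rfl
  | succ m ih =>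
    change chainStep _ _ = chainStep _ _
    rw [ih fun k hk => h k (hk.trans m.lt_succ_self), h m m.lt_succ_self]

/-- While the chain is alive all elapsed time is recorded at some site of `Λ`. This turns decay in
the total field into decay along the jump times. -/
theorem sum_chainPath {t : Λ → ℝ} {a : Λ} {w : ℕ → Site d × ℝ} (m : ℕ) {z : Λ}
    (h : (chainPath t a w m).2 = some z) :
    ∑ x, (chainPath t a w m).1 x = ∑ x, t x + jumpTime w m := by
  induction m generalizing z with
  | zero => simp [chainPath, jumpTime]
  | succ m ih =>
    obtain ⟨y, hy, -, hs⟩ := chainPath_succ_snd_eq_some h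
    rw [hs, sum_add_single, ih hy, jumpTime_succ, add_assoc]

theorem abs_killedExt_chainPath_le {K : (Λ → ℝ) → Λ → ℝ} {D : ℝ} (hD : 0 ≤ D)
    (hK : ∀ s x, |K s x| ≤ D * Real.exp (-8 * ∑ x, s x)) (t : Λ → ℝ) (a : Λ)
    (w : ℕ → Site d × ℝ) (m : ℕ) :
    |killedExt K (chainPath t a w m)| ≤ D * Real.exp (-8 * (∑ x, t x + jumpTime w m)) := by
  rw [killedExt]
  cases e : (chainPath t a w m).2 with
  | none =>
    simp
    positivity
  | some z =>
    rw [← sum_chainPath m e]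
    exact hK _ z

theorem abs_sojourn_chainPath_le {Z : (Λ → ℝ) → ℝ} {D : ℝ} (hD : 0 ≤ D) (hZ : Continuous Z)
    (hpos : ∀ s, 0 < Z s) (h : ∀ s, Z s ≤ D * Real.exp (-8 * ∑ x, s x)) (b : Λ) (t : Λ → ℝ)
    (a : Λ) (w : ℕ → Site d × ℝ) (m : ℕ) {r : ℝ} (hr : 0 ≤ r) :
    |sojourn Z b (chainPath t a w m) r| ≤
      D * Real.exp (-8 * (∑ x, t x + jumpTime w m)) := by
  rw [sojourn]
  split_ifs with e
  · rw [← sum_chainPath m e]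
    exact integral_le_of_le_exp hD hZ hpos h _ b hr
  · simp
    positivity

theorem sojourn_nonneg {Z : (Λ → ℝ) → ℝ} (hpos : ∀ s, 0 < Z s) (b : Λ) (S : ChainState Λ) {r : ℝ}
    (hr : 0 ≤ r) : 0 ≤ sojourn Z b S r := by
  rw [sojourn]
  split_ifs
  · exact intervalIntegral.integral_nonneg hr fun ρ _ => (hpos _).le
  · exact le_rfl

variable {Ω : Type*} [MeasurableSpace Ω] {P : Measure Ω}
  {W : ℕ → Ω → Site d × ℝ}

/-- Independent identically distributed pairs of a displacement and a positive holding time. -/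
structure IsDriving (J : Site d → ℝ) (P : Measure Ω) (W : ℕ → Ω → Site d × ℝ) : Prop where
  measurable : ∀ k, Measurable (W k)
  indep : iIndepFun W P
  map_eq : ∀ k, P.map (W k) = (stepLaw J).prod (expMeasure (totalRate J))
  pos : ∀ k ω, 0 < (W k ω).2

variable {J : Site d → ℝ}

theorem IsDriving.measurable_chainPath (hW : IsDriving J P W) (t : Λ → ℝ) (a : Λ) (m : ℕ) :
    Measurable fun ω => chainPath t a (fun k => W k ω) m :=
  (Phi4.measurable_chainPath t a m).comp (measurable_pi_lambda _ hW.measurable)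

theorem IsDriving.measurable_jumpTime (hW : IsDriving J P W) (m : ℕ) :
    Measurable fun ω => jumpTime (fun k => W k ω) m :=
  Finset.measurable_fun_sum _ fun k _ => (hW.measurable k).snd

/-- The state after `m` steps uses only the pairs with index below `m`. -/
theorem IsDriving.indepFun_chainPath (hW : IsDriving J P W) (t : Λ → ℝ) (a : Λ) (m : ℕ) :
    IndepFun (fun ω => chainPath t a (fun k => W k ω) m) (W m) P := by
  classical
  have h := hW.indep.indepFun_finset (Finset.range m) {m} (by simp) hW.measurable
  -- The value `(0, 0)` only pads the sequence; `chainPath_congr` shows that it is never read.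
  let φ : (Finset.range m → Site d × ℝ) → ChainState Λ := fun v =>
    chainPath t a (fun k => if hk : k ∈ Finset.range m then v ⟨k, hk⟩ else (0, 0)) m
  have hφ : Measurable φ := by
    refine (Phi4.measurable_chainPath t a m).comp (measurable_pi_lambda _ fun k => ?_)
    by_cases hk : k ∈ Finset.range m
    · simp only [hk, dif_pos]
      exact measurable_pi_apply _
    · simp only [hk, dif_neg, not_false_iff]
      exact measurable_const
  have h2 := h.comp hφ (measurable_pi_apply (⟨m, Finset.mem_singleton_self m⟩ : ({m} : Finset ℕ)))
  refine h2.congr (Filter.Eventually.of_forall fun ω => ?_)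
    (Filter.Eventually.of_forall fun ω => rfl)
  refine chainPath_congr t a m fun k hk => ?_
  simp [hk]

/-- A random walk is driven by independent pairs with everywhere positive holding times. -/
theorem IsRandomWalk.exists_isDriving (hd : 1 ≤ d) (hJ : IsJumpRate J) {a : Site d}
    {X : ℝ → Ω → Site d} (hX : IsRandomWalk J a P X) :
    ∃ W : ℕ → Ω → Site d × ℝ, IsDriving J P W ∧
      ∀ᵐ ω ∂P, FollowsJumps X ω a fun k => W k ω := by
  have := isProbabilityMeasure_stepLaw hd hJ
  have := isProbabilityMeasure_expMeasure (hJ.totalRate_pos hd)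
  obtain ⟨Y, σ, hY0, hind, hlaw, hpath⟩ := hX
  let V : ℕ → Ω → Site d × ℝ := fun k ω => (Y (k + 1) ω - Y k ω, σ k ω)
  have hVm : ∀ k, AEMeasurable (V k) P := fun k => (hlaw k).aemeasurable
  have hVmap : ∀ k, P.map (V k) = (stepLaw J).prod (expMeasure (totalRate J)) := fun k =>
    (hlaw k).map_eq
  have hVpos : ∀ k, ∀ᵐ ω ∂P, 0 < (V k ω).2 := fun k => by
    have h1 : ∀ᵐ w ∂(stepLaw J).prod (expMeasure (totalRate J)), 0 < w.2 :=
      Measure.quasiMeasurePreserving_snd.ae (ae_pos_expMeasure (totalRate J))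
    rw [← hVmap k] at h1
    exact ae_of_ae_map (hVm k) h1
  -- Non-positive holding times, which have probability zero, are replaced by 1. Together with a
  -- measurable version this gives measurability and positivity everywhere without changing the law.
  let c : Site d × ℝ → Site d × ℝ := fun w => (w.1, if 0 < w.2 then w.2 else 1)
  have hc : Measurable c := measurable_fst.prodMk (Measurable.ite
    (measurableSet_lt measurable_const measurable_snd) measurable_snd measurable_const)
  let W : ℕ → Ω → Site d × ℝ := fun k ω => c ((hVm k).mk (V k) ω)
  have hVW : ∀ k, V k =ᵐ[P] W k := fun k => by
    filter_upwards [(hVm k).ae_eq_mk, hVpos k] with ω h1 h2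
    simp only [W, c]
    rw [← h1, if_pos h2]
  refine ⟨W, ⟨fun k => hc.comp (hVm k).measurable_mk, iIndepFun.congr hVW hind, fun k => ?_,
    fun k ω => ?_⟩, ?_⟩
  · rw [← hVmap k]
    exact (Measure.map_congr (hVW k)).symm
  · simp only [W, c]
    split_ifs with h
    · exact h
    · exact one_pos
  · filter_upwards [hY0, hpath, ae_all_iff.mpr hVW] with ω h0 hω hall
    have hT : ∀ m, ∑ k ∈ Finset.range m, σ k ω = jumpTime (fun k => W k ω) m := fun m =>
      Finset.sum_congr rfl fun k _ => congrArg Prod.snd (hall k)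
    have hP : ∀ m, Y m ω = jumpPos a (fun k => W k ω) m := fun m => by
      induction m with
      | zero => simp [jumpPos, h0]
      | succ m ih =>
        rw [jumpPos_succ, ← ih, ← hall m]
        simp [V]
    intro ℓ m hℓ h1 h2
    rw [← hP]
    rw [← hT] at h1 h2
    exact hω ℓ m hℓ h1 h2

variable [IsProbabilityMeasure P]

/-- The strong law applies to the holding times truncated at 1, which are bounded and of positive
mean; their sums grow linearly and minorise the jump times. -/
theorem IsDriving.ae_tendsto_jumpTime (hW : IsDriving J P W) :
    ∀ᵐ ω ∂P, Filter.Tendsto (jumpTime fun k => W k ω) Filter.atTop Filter.atTop := by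
  let f : Site d × ℝ → ℝ := fun w => min w.2 1
  have hf : Measurable f := measurable_snd.min measurable_const
  let V : ℕ → Ω → ℝ := fun k => f ∘ W k
  have hVpos : ∀ k ω, 0 < V k ω := fun k ω => lt_min (hW.pos k ω) one_pos
  have hint : Integrable (V 0) P := by
    refine Integrable.of_bound (hf.comp (hW.measurable 0)).aestronglyMeasurable 1
      (Filter.Eventually.of_forall fun ω => ?_)
    rw [Real.norm_eq_abs, abs_of_pos (hVpos 0 ω)]
    exact min_le_right _ _
  have hlaw := strong_law_ae_real V hint
    (fun i j hij => (hW.indep.indepFun hij).comp hf hf)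
    (fun i => IdentDistrib.comp ⟨(hW.measurable i).aemeasurable, (hW.measurable 0).aemeasurable,
      (hW.map_eq i).trans (hW.map_eq 0).symm⟩ hf)
  have hmean : 0 < ∫ ω, V 0 ω ∂P := by
    rw [integral_pos_iff_support_of_nonneg (fun ω => (hVpos 0 ω).le) hint]
    have : Function.support (V 0) = Set.univ := Set.eq_univ_of_forall fun ω => (hVpos 0 ω).ne'
    rw [this, measure_univ]
    exact one_pos
  filter_upwards [hlaw] with ω hω
  have h1 := hω.pos_mul_atTop hmean (tendsto_natCast_atTop_atTop (R := ℝ))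
  refine Filter.tendsto_atTop_mono' _ ?_ h1
  filter_upwards [Filter.eventually_gt_atTop 0] with n hn
  have hn' : (n : ℝ) ≠ 0 := by positivity
  rw [div_mul_cancel₀ _ hn']
  exact Finset.sum_le_sum fun k _ => min_le_left _ _

variable {b : Λ} {K : (Λ → ℝ) → Λ → ℝ} {Z : (Λ → ℝ) → ℝ}

/-- `IsRenewalPair.one_step` averaged over the current state. By independence the state and the next
pair have a product law, so Fubini plays the role of conditioning on the past. -/
theorem IsRenewalPair.integral_step (hd : 1 ≤ d) (hJ : IsJumpRate J) (h : IsRenewalPair J b K Z)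
    (hW : IsDriving J P W) (t : Λ → ℝ) (a : Λ) (m : ℕ) :
    ∫ ω, killedExt K (chainPath t a (fun k => W k ω) m) ∂P =
      ∫ ω, sojourn Z b (chainPath t a (fun k => W k ω) m) (W m ω).2 ∂P +
        ∫ ω, killedExt K (chainPath t a (fun k => W k ω) (m + 1)) ∂P := by
  have := isProbabilityMeasure_stepLaw hd hJ
  have := isProbabilityMeasure_expMeasure (hJ.totalRate_pos hd)
  obtain ⟨D, hD, hK, hZ⟩ := h.bound
  have hbound : ∀ m ω, D * Real.exp (-8 * (∑ x, t x + jumpTime (fun k => W k ω) m)) ≤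
      D * Real.exp (-8 * ∑ x, t x) := fun m ω => by
    have := jumpTime_nonneg (fun k => hW.pos k ω) m
    gcongr D * Real.exp ?_
    linarith
  have hmS := hW.measurable_chainPath t a m
  have hmK := measurable_killedExt h.continuous_left
  have hmZ := measurable_sojourn h.continuous_right b
  have hi1 : Integrable (fun ω => sojourn Z b (chainPath t a (fun k => W k ω) m) (W m ω).2) P :=
    Integrable.of_bound (hmZ.comp (hmS.prodMk (hW.measurable m).snd)).aestronglyMeasurable _
      (Filter.Eventually.of_forall fun ω =>
        (abs_sojourn_chainPath_le hD h.continuous_right h.pos hZ b t a _ m (hW.pos m ω).le).trans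
          (hbound m ω))
  have hi2 : Integrable (fun ω => killedExt K (chainPath t a (fun k => W k ω) (m + 1))) P :=
    Integrable.of_bound (hmK.comp (hW.measurable_chainPath t a (m + 1))).aestronglyMeasurable _
      (Filter.Eventually.of_forall fun ω =>
        (abs_killedExt_chainPath_le hD hK t a _ (m + 1)).trans (hbound (m + 1) ω))
  let f : ChainState Λ × (Site d × ℝ) → ℝ := fun p =>
    sojourn Z b p.1 p.2.2 + killedExt K (chainStep p.1 p.2)
  have hf : Measurable f :=
    (hmZ.comp (measurable_fst.prodMk measurable_snd.snd)).add (hmK.comp measurable_chainStep)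
  have hpair : P.map (fun ω => (chainPath t a (fun k => W k ω) m, W m ω)) =
      (P.map fun ω => chainPath t a (fun k => W k ω) m).prod
        ((stepLaw J).prod (expMeasure (totalRate J))) := by
    rw [← hW.map_eq m]
    exact (indepFun_iff_map_prod_eq_prod_map_map hmS.aemeasurable
      (hW.measurable m).aemeasurable).mp (hW.indepFun_chainPath t a m)
  have hmp : Measurable fun ω => (chainPath t a (fun k => W k ω) m, W m ω) :=
    hmS.prodMk (hW.measurable m)
  have hfi : Integrable f ((P.map fun ω => chainPath t a (fun k => W k ω) m).prod
        ((stepLaw J).prod (expMeasure (totalRate J)))) := by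
    rw [← hpair, integrable_map_measure hf.aestronglyMeasurable hmp.aemeasurable]
    exact hi1.add hi2
  rw [← integral_add hi1 hi2]
  change _ = ∫ ω, f (chainPath t a (fun k => W k ω) m, W m ω) ∂P
  rw [← integral_map hmp.aemeasurable hf.aestronglyMeasurable, hpair, integral_prod _ hfi,
    ← integral_map hmS.aemeasurable hmK.aestronglyMeasurable]
  exact integral_congr_ae (Filter.Eventually.of_forall fun S => h.one_step hd hJ S)

/-- Dominated convergence: `K` along the chain is at most a constant times `exp (-8 · jump time)`,
or zero after killing. -/
theorem IsRenewalPair.tendsto_remainder (h : IsRenewalPair J b K Z)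
    (hW : IsDriving J P W) (t : Λ → ℝ) (a : Λ) :
    Filter.Tendsto (fun m => ∫ ω, killedExt K (chainPath t a (fun k => W k ω) m) ∂P)
      Filter.atTop (nhds 0) := by
  obtain ⟨D, hD, hK, hZ⟩ := h.bound
  have hlim := tendsto_integral_of_dominated_convergence (μ := P)
    (F := fun m ω => killedExt K (chainPath t a (fun k => W k ω) m)) (f := fun _ => 0)
    (fun _ => D * Real.exp (-8 * ∑ x, t x))
    (fun m => ((measurable_killedExt h.continuous_left).comp
      (hW.measurable_chainPath t a m)).aestronglyMeasurable)
    (integrable_const _)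
    (fun m => Filter.Eventually.of_forall fun ω => by
      refine (abs_killedExt_chainPath_le hD hK t a _ m).trans ?_
      have := jumpTime_nonneg (fun k => hW.pos k ω) m
      gcongr D * Real.exp ?_
      linarith) ?_
  · simpa using hlim
  · filter_upwards [hW.ae_tendsto_jumpTime] with ω hω
    refine squeeze_zero_norm (fun m => abs_killedExt_chainPath_le hD hK t a _ m) ?_
    have h1 : Filter.Tendsto (fun m => -8 * (∑ x, t x + jumpTime (fun k => W k ω) m))
        Filter.atTop Filter.atBot :=
      (Filter.tendsto_atTop_add_const_left _ _ hω).const_mul_atTop_of_neg (by norm_num)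
    simpa using (Real.tendsto_exp_atBot.comp h1).const_mul D

/-- The two-point function as the expected weight collected at `b`. -/
theorem IsRenewalPair.hasSum (hd : 1 ≤ d) (hJ : IsJumpRate J) (h : IsRenewalPair J b K Z)
    (hW : IsDriving J P W) (t : Λ → ℝ) (a : Λ) :
    HasSum (fun m => ∫ ω, sojourn Z b (chainPath t a (fun k => W k ω) m) (W m ω).2 ∂P)
      (K t a) := by
  -- The terms are non-negative, so convergence of the telescoping partial sums already gives the
  -- sum.
  rw [hasSum_iff_tendsto_nat_of_nonneg fun m =>
    integral_nonneg fun ω => sojourn_nonneg h.pos b _ (hW.pos m ω).le]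
  have htel : ∀ M, ∑ m ∈ Finset.range M,
      ∫ ω, sojourn Z b (chainPath t a (fun k => W k ω) m) (W m ω).2 ∂P =
      K t a - ∫ ω, killedExt K (chainPath t a (fun k => W k ω) M) ∂P := by
    intro M
    induction M with
    | zero => simp [chainPath, killedExt]
    | succ M ih =>
      rw [Finset.sum_range_succ, ih, h.integral_step hd hJ hW t a M]
      ring
  simp only [htel]
  simpa using (h.tendsto_remainder hW t a).const_sub (K t a)

theorem measurable_holdingTerm {F : (Λ → ℝ) → ℝ} (hF : Continuous F) (b : Λ) :
    Measurable fun p : ChainState Λ × (ℝ × ℝ × ℝ) =>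
      holdingTerm F b p.1 p.2.1 p.2.2.1 p.2.2.2 := by
  unfold holdingTerm
  refine Measurable.ite ?_ ?_ measurable_const
  · refine MeasurableSet.inter (MeasurableSet.inter ?_ ?_) ?_
    · exact measurableSet_le (measurable_snd.fst) (measurable_snd.snd.snd)
    · exact measurableSet_lt measurable_snd.snd.snd
        (measurable_snd.fst.add measurable_snd.snd.fst)
    · exact measurable_fst.snd (MeasurableSet.of_discrete (s := {some b}))
  · exact ((hF.comp (continuous_add_single_prod b)).measurable.comp
      (measurable_fst.fst.prodMk (measurable_snd.snd.snd.sub measurable_snd.fst))).ennreal_ofReal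

open Classical in
-- Everything is non-negative, so Tonelli exchanges both integrals and the sum over holding
-- intervals; each interval contributes one expected sojourn weight, summed by
-- `IsRenewalPair.hasSum`.
theorem IsRenewalPair.lintegral_green (hd : 1 ≤ d) (hJ : IsJumpRate J) (h : IsRenewalPair J b K Z)
    (hW : IsDriving J P W) (t : Λ → ℝ) (a : Λ) {X : ℝ → Ω → Site d}
    (hX : ∀ᵐ ω ∂P, FollowsJumps X ω a fun k => W k ω) :
    ∫⁻ ℓ in Set.Ici (0 : ℝ), ∫⁻ ω, (if killedWalk Λ X ℓ ω = some (b : Site d) then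
      ENNReal.ofReal (Z (t + localTime Λ X (Set.Icc 0 ℓ) ω) / Z t) else 0) ∂P =
      ENNReal.ofReal (K t a / Z t) := by
  obtain ⟨D, hD, hK, hZ⟩ := h.bound
  have hF : Continuous fun s => Z s / Z t := h.continuous_right.div_const _
  have hmS := hW.measurable_chainPath t a
  have hjoint : ∀ m, Measurable fun p : ℝ × Ω => holdingTerm (fun s => Z s / Z t) b
      (chainPath t a (fun k => W k p.2) m) (jumpTime (fun k => W k p.2) m) (W m p.2).2 p.1 :=
    fun m => (measurable_holdingTerm hF b).comp (((hmS m).comp measurable_snd).prodMk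
      (((hW.measurable_jumpTime m).comp measurable_snd).prodMk
        ((((hW.measurable m).snd).comp measurable_snd).prodMk measurable_fst)))
  have hterm : ∀ m, ∫⁻ ℓ in Set.Ici (0 : ℝ), ∫⁻ ω, holdingTerm (fun s => Z s / Z t) b
      (chainPath t a (fun k => W k ω) m) (jumpTime (fun k => W k ω) m) (W m ω).2 ℓ ∂P =
      ENNReal.ofReal ((∫ ω, sojourn Z b (chainPath t a (fun k => W k ω) m) (W m ω).2 ∂P) / Z t) := by
    intro m
    rw [lintegral_lintegral_swap (hjoint m).aemeasurable]
    have e : ∀ ω, ∫⁻ ℓ in Set.Ici (0 : ℝ), holdingTerm (fun s => Z s / Z t) b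
      (chainPath t a (fun k => W k ω) m) (jumpTime (fun k => W k ω) m) (W m ω).2 ℓ =
      ENNReal.ofReal (sojourn Z b (chainPath t a (fun k => W k ω) m) (W m ω).2 / Z t) := fun ω =>
      lintegral_holdingTerm h.continuous_right h.pos (h.pos t) b _
        (jumpTime_nonneg (fun k => hW.pos k ω) m) (hW.pos m ω)
    simp only [e]
    rw [← integral_div, ofReal_integral_eq_lintegral_ofReal]
    · refine Integrable.div_const (Integrable.of_bound ((measurable_sojourn h.continuous_right b).comp
        ((hmS m).prodMk (hW.measurable m).snd)).aestronglyMeasurable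
        (D * Real.exp (-8 * ∑ x, t x)) (Filter.Eventually.of_forall fun ω => ?_)) _
      refine (abs_sojourn_chainPath_le hD h.continuous_right h.pos hZ b t a _ m
        (hW.pos m ω).le).trans ?_
      have := jumpTime_nonneg (fun k => hW.pos k ω) m
      gcongr D * Real.exp ?_
      linarith
    · exact Filter.Eventually.of_forall fun ω =>
        div_nonneg (sojourn_nonneg h.pos b _ (hW.pos m ω).le) (h.pos t).le
  calc _ = ∫⁻ ℓ in Set.Ici (0 : ℝ), ∑' m, ∫⁻ ω, holdingTerm (fun s => Z s / Z t) b
          (chainPath t a (fun k => W k ω) m) (jumpTime (fun k => W k ω) m) (W m ω).2 ℓ ∂P := by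
        -- No measurability of `X` enters: for each `ℓ` the integrand is almost surely a sum of
        -- jointly measurable terms of the driving sequence.
        refine setLIntegral_congr_fun measurableSet_Ici fun ℓ hℓ => ?_
        refine Eq.trans (lintegral_congr_ae ?_) (lintegral_tsum fun m =>
          ((hjoint m).comp (measurable_prodMk_left (x := ℓ))).aemeasurable)
        filter_upwards [hX, hW.ae_tendsto_jumpTime] with ω hXω hTω
        exact hXω.integrand_eq_tsum (fun k => hW.pos k ω) hTω (fun s => Z s / Z t) b hℓ
    _ = ∑' m, ∫⁻ ℓ in Set.Ici (0 : ℝ), ∫⁻ ω, holdingTerm (fun s => Z s / Z t) b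
          (chainPath t a (fun k => W k ω) m) (jumpTime (fun k => W k ω) m) (W m ω).2 ℓ ∂P :=
        lintegral_tsum fun m => (Measurable.lintegral_prod_right' (hjoint m)).aemeasurable
    _ = ENNReal.ofReal (K t a / Z t) := by
        have hs := (h.hasSum hd hJ hW t a).div_const (Z t)
        simp only [hterm]
        rw [← ENNReal.ofReal_tsum_of_nonneg _ hs.summable, hs.tsum_eq]
        exact fun m => div_nonneg (integral_nonneg fun ω =>
          sojourn_nonneg h.pos b _ (hW.pos m ω).le) (h.pos t).le

end Renewal

/-! ### Passing between the normalised and unnormalised spin integrals -/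

section Normalisation

variable {d : ℕ} {Λ : Finset (Site d)} {n : ℕ} {J : Site d → ℝ}

theorem integral_gaussianMeasure (hd : 1 ≤ d) (hJ : IsJumpRate J) (F : SpinConfig Λ n → ℝ) :
    ∫ φ, F φ ∂gaussianMeasure J Λ n =
      gaussianConst J Λ n * ∫ φ, Real.exp (1 / 2 * dirichletForm J Λ φ) * F φ := by
  have hC := gaussianConst_pos (Λ := Λ) (n := n) hd hJ
  have hm : Measurable fun φ : SpinConfig Λ n =>
      ENNReal.ofReal (gaussianConst J Λ n * Real.exp (1 / 2 * dirichletForm J Λ φ)) :=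
    (continuous_const.mul (Real.continuous_exp.comp
      (continuous_const.mul (continuous_dirichletForm J)))).measurable.ennreal_ofReal
  rw [gaussianMeasure, integral_withDensity_eq_integral_toReal_smul hm
    (Filter.Eventually.of_forall fun _ => ENNReal.ofReal_lt_top), ← integral_const_mul]
  refine integral_congr_ae (Filter.Eventually.of_forall fun φ => ?_)
  simp only [smul_eq_mul]
  rw [ENNReal.toReal_ofReal (by positivity)]
  ring

theorem phi4Z_eq (hd : 1 ≤ d) (hJ : IsJumpRate J) (g ν : ℝ) (s : Λ → ℝ) :
    phi4Z J Λ n g ν s = gaussianConst J Λ n * partitionFn J n g ν s := by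
  rw [phi4Z, integral_gaussianMeasure hd hJ, partitionFn]
  congr 1
  refine integral_congr_ae (Filter.Eventually.of_forall fun φ => ?_)
  simp only [spinWeight, interaction, potential]
  rw [← Real.exp_sum, Finset.sum_neg_distrib]

theorem integrable_inner_mul_interaction (hd : 1 ≤ d) (hJ : IsJumpRate J) {g : ℝ} (hg : 0 < g)
    (ν : ℝ) (s : Λ → ℝ) (a b : Λ) :
    Integrable (fun φ : SpinConfig Λ n => inner ℝ (φ a) (φ b) * interaction g ν s φ)
      (gaussianMeasure J Λ n) := by
  have hC := gaussianConst_pos (Λ := Λ) (n := n) hd hJ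
  have hm : Measurable fun φ : SpinConfig Λ n =>
      ENNReal.ofReal (gaussianConst J Λ n * Real.exp (1 / 2 * dirichletForm J Λ φ)) :=
    (continuous_const.mul (Real.continuous_exp.comp
      (continuous_const.mul (continuous_dirichletForm J)))).measurable.ennreal_ofReal
  rw [gaussianMeasure, integrable_withDensity_iff_integrable_smul' hm
    (Filter.Eventually.of_forall fun _ => ENNReal.ofReal_lt_top)]
  refine ((integrable_inner_mul_spinWeight hd hJ hg ν s a b).const_mul
    (gaussianConst J Λ n)).congr (Filter.Eventually.of_forall fun φ => ?_)
  simp only [smul_eq_mul, spinWeight]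
  rw [ENNReal.toReal_ofReal (by positivity)]
  ring

theorem spinExpectation_inner (hd : 1 ≤ d) (hJ : IsJumpRate J) (hn : 1 ≤ n) (g ν : ℝ)
    (s : Λ → ℝ) (a b : Λ) :
    1 / (n : ℝ) * spinExpectation J Λ n g ν s (fun φ => inner ℝ (φ a) (φ b)) =
      twoPoint J n g ν b s a / partitionFn J n g ν s := by
  have hC := (gaussianConst_pos (Λ := Λ) (n := n) hd hJ).ne'
  have hn0 : (n : ℝ) ≠ 0 := by positivity
  rw [spinExpectation, phi4Z_eq hd hJ, integral_gaussianMeasure hd hJ, twoPoint]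
  have : ∀ φ : SpinConfig Λ n, Real.exp (1 / 2 * dirichletForm J Λ φ) *
      (inner ℝ (φ a) (φ b) * interaction g ν s φ) = inner ℝ (φ a) (φ b) * spinWeight J g ν s φ :=
    fun φ => by rw [spinWeight]; ring
  simp only [this]
  rw [one_div_mul_eq_div (gaussianConst J Λ n * _), mul_div_mul_left _ _ hC]
  ring

end Normalisation

end Phi4

theorem theorem3p3 {d : ℕ} (hd : 1 ≤ d) (J : Phi4.Site d → ℝ) (hJ : Phi4.IsJumpRate J)
    (Λ : Finset (Phi4.Site d)) (n : ℕ) (hn : 1 ≤ n) (g ν : ℝ) (hg : 0 < g)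
    (t : Λ → ℝ) (ht : ∀ x, 0 ≤ t x) (a b : Λ)
    {Ω : Type*} [MeasurableSpace Ω] (P : Measure Ω) [IsProbabilityMeasure P]
    (X : ℝ → Ω → Phi4.Site d) (hX : Phi4.IsRandomWalk J (a : Phi4.Site d) P X) :
    0 < Phi4.phi4Z J Λ n g ν t ∧
    Integrable (fun φ : Phi4.SpinConfig Λ n => inner ℝ (φ a) (φ b) * Phi4.interaction g ν t φ)
      (Phi4.gaussianMeasure J Λ n) ∧
    Phi4.greenFunction Λ P X (Phi4.phi4Z J Λ n g ν) t b ≠ ⊤ ∧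
    (Phi4.greenFunction Λ P X (Phi4.phi4Z J Λ n g ν) t b).toReal =
      1 / (n : ℝ) * Phi4.spinExpectation J Λ n g ν t (fun φ => inner ℝ (φ a) (φ b)) := by
  have h := Phi4.isRenewalPair hd hJ hn hg ν b
  have hZ : ∀ s : Λ → ℝ, Phi4.phi4Z J Λ n g ν s =
      Phi4.gaussianConst J Λ n * Phi4.partitionFn J n g ν s := Phi4.phi4Z_eq hd hJ g ν
  have hC := Phi4.gaussianConst_pos (Λ := Λ) (n := n) hd hJ
  obtain ⟨W, hW, hfollow⟩ := hX.exists_isDriving hd hJ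
  -- The Gaussian constant cancels from the ratio of partition functions.
  have hgreen : Phi4.greenFunction Λ P X (Phi4.phi4Z J Λ n g ν) t b =
      ENNReal.ofReal (Phi4.twoPoint J n g ν b t a / Phi4.partitionFn J n g ν t) := by
    rw [← h.lintegral_green hd hJ hW t a hfollow, Phi4.greenFunction]
    simp only [hZ, mul_div_mul_left _ _ hC.ne']
  -- Positivity of the correlation is read off its walk representation; without it `ENNReal.ofReal`
  -- would truncate to zero.
  have hnonneg : 0 ≤ Phi4.twoPoint J n g ν b t a :=
    (h.hasSum hd hJ hW t a).nonneg fun m =>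
      integral_nonneg fun ω => Phi4.sojourn_nonneg h.pos b _ (hW.pos m ω).le
  refine ⟨?_, Phi4.integrable_inner_mul_interaction hd hJ hg ν t a b, ?_, ?_⟩
  · rw [hZ]
    exact mul_pos hC (h.pos t)
  · rw [hgreen]
    exact ENNReal.ofReal_ne_top
  · rw [hgreen, ENNReal.toReal_ofReal (div_nonneg hnonneg (h.pos t).le),
      Phi4.spinExpectation_inner hd hJ hn]
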